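/- Let $0<q<1$ and $l>0$. Put $[a]_q=\frac{q^{a/2}-q^{-a/2}}{q^{1/2}-q^{-1/2}}$, $(a;q)_n=\prod_{i=0}^{n-1}(1-aq^i)$, $(a;q)_\infty=\prod_{i\ge 0}(1-aq^i)$, and let $f_n=c_nx^n$ with $c_n=\prod_{k=1}^n [2l+k-1]_q^{1/2}/[k]_q^{1/2}$, $n=0,1,2,\dots$. Let $\mathcal H_l$ be the complex Hilbert space of all series $\sum_n b_nf_n$ with $\sum_n|b_n|^2<\infty$, in which $(f_n)$ is an orthonormal basis. On formal power series in $x$ consider $J_0=x\frac{d}{dx}+l$, $J_\pm=x^{\pm1}[J_0\pm l]_q$ (the discrete series representation of $U_q(\mathrm{su}_{1,1})$ with lowest weight $l$) and $$I_3=-\tfrac12\,q^{-3J_0/4}(J_++J_-)q^{-3J_0/4}+\frac{1+q}{2(1-q)}q^{-2J_0}-\frac{q^l+q^{1-l}}{2(1-q)}q^{-J_0}.$$ (1) As an operator in $\mathcal H_l$ with the polynomials in $x$ as its domain, $I_3$ is densely defined, unbounded, symmetric and closable. Its closure $\overline{I_3}$ is symmetric but not selfadjoint, has deficiency indices $(1,1)$,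 that is, $\dim\ker(I_3^*-i)=\dim\ker(I_3^*+i)=1$, and has infinitely many selfadjoint extensions in $\mathcal H_l$. (2) For $\lambda\in\mathbb C$ put $\zeta_\lambda=\sum_{n\ge0}P_n(\lambda)f_n$, where $$P_n(\lambda)=q^{n/2}\frac{(q;q)_n^{1/2}}{(q^{2l};q)_n^{1/2}}\,L_n^{(2l-1)}(2(1-q)\lambda;q)$$ and $$L_n^{(\alpha)}(y;q)=\frac{(q^{\alpha+1};q)_n}{(q;q)_n}\sum_{k=0}^n\frac{(q^{-n};q)_k\,y^k}{(q^{\alpha+1};q)_k(q;q)_k}\,q^{k(n+\alpha+(k+1)/2)}$$ are the $q$-Laguerre polynomials. Then the formal power series $\zeta$ with $I_3\zeta=\lambda\zeta$ are exactly the scalar multiples of $\zeta_\lambda$. Moreover $\zeta_\lambda\in\mathcal H_l$, $\langle \zeta_\lambda,f_n\rangle=P_n(\lambda)$ (inner product linear in the first argument) for all $n$, $\zeta_\lambda$ lies in the domain of the adjoint $I_3^*=\overline{I_3}^{\,*}$, and $I_3^*\zeta_\lambda=\lambda\zeta_\lambda$. With $\nu=2(1-q)\lambda$, the power series $\zeta_\lambda$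 converges for complex $x$ with $|x|<q^{(2l-3)/4}$ and $$\zeta_\lambda(x)=\frac{1}{(q^{(3-2l)/4}x;q)_\infty}\;{}_1\phi_1\bigl(-\nu;\,0;\,q;\,q^{3(1+2l)/4}x\bigr),$$ where ${}_1\phi_1(a;b;q;z)=\sum_{k\ge0}\frac{(a;q)_k}{(b;q)_k(q;q)_k}(-1)^kq^{k(k-1)/2}z^k$. -/

import Mathlib

open scoped PowerSeries LinearPMap

noncomputable section

namespace QSU11

/-- The `q`-number `[a]_q = (q^{a/2} - q^{-a/2}) / (q^{1/2} - q^{-1/2})`. -/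
def qNum (q a : ℝ) : ℝ :=
  (q ^ (a / 2) - q ^ (-(a / 2))) / (q ^ (1 / 2 : ℝ) - q ^ (-(1 / 2 : ℝ)))

/-- The finite `q`-shifted factorial `(a;q)_n = (1 - a)(1 - a q) ⋯ (1 - a q^{n-1})`. -/
def qPoch {R : Type*} [CommRing R] (a q : R) (n : ℕ) : R :=
  ∏ i ∈ Finset.range n, (1 - a * q ^ i)

/-- The infinite `q`-shifted factorial `(a;q)_∞`, for `|q| < 1`. -/
def qPochInf (a q : ℂ) : ℂ :=
  ∏' i : ℕ, (1 - a * q ^ i)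

/-- The basic hypergeometric function
`₁φ₁(a; b; q; z) = ∑_k (a;q)_k / ((b;q)_k (q;q)_k) (-1)^k q^{k(k-1)/2} z^k`. -/
def phi11 (a b q z : ℂ) : ℂ :=
  ∑' k : ℕ, qPoch a q k / (qPoch b q k * qPoch q q k) *
    ((-1) ^ k * q ^ (k * (k - 1) / 2)) * z ^ k

/-- The `q`-Laguerre polynomial
`L_n^{(α)}(y;q) = (q^{α+1};q)_n / (q;q)_n *
  ∑_{k ≤ n} (q^{-n};q)_k y^k / ((q^{α+1};q)_k (q;q)_k) q^{k (n + α + (k+1)/2)}`. -/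
def qLaguerre (q α : ℝ) (n : ℕ) (y : ℂ) : ℂ :=
  ((qPoch (q ^ (α + 1)) q n / qPoch q q n : ℝ) : ℂ) *
    ∑ k ∈ Finset.range (n + 1),
      ((qPoch (q ^ (-(n : ℝ))) q k / (qPoch (q ^ (α + 1)) q k * qPoch q q k) *
        q ^ ((k : ℝ) * (n + α + ((k : ℝ) + 1) / 2)) : ℝ) : ℂ) * y ^ k

/-- The normalization `c_n = ∏_{k=1}^n [2l+k-1]_q^{1/2} / [k]_q^{1/2}` of the monomials. -/
def normConst (q l : ℝ) (n : ℕ) : ℝ :=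
  ∏ k ∈ Finset.range n, (√(qNum q (2 * l + k)) / √(qNum q (k + 1)))

/-! ### The representation of `U_q(su_{1,1})` with lowest weight `l`

The generators act on formal power series in `x`; polynomials are mapped to polynomials. -/

/-- The function `g(J₀)` of `J₀ = x d/dx + l`, that is, `x^n ↦ g(l + n) x^n`. -/
def funJ0 (l : ℝ) (g : ℝ → ℝ) : ℂ⟦X⟧ →ₗ[ℂ] ℂ⟦X⟧ where
  toFun f := PowerSeries.mk fun n => (g (l + n) : ℂ) * PowerSeries.coeff n f
  map_add' f h := by ext n; simp [mul_add]
  map_smul' a f := by ext n; simp [mul_left_comm]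

/-- Multiplication by `x`. -/
def mulX : ℂ⟦X⟧ →ₗ[ℂ] ℂ⟦X⟧ := LinearMap.mulLeft ℂ (PowerSeries.X : ℂ⟦X⟧)

/-- Multiplication by `x⁻¹` (applied only to series without constant term). -/
def divX : ℂ⟦X⟧ →ₗ[ℂ] ℂ⟦X⟧ where
  toFun f := PowerSeries.mk fun n => PowerSeries.coeff (n + 1) f
  map_add' f h := by ext n; simp
  map_smul' a f := by ext n; simp

/-- `q^{a J₀}`. -/
def qPowJ0 (q l a : ℝ) : ℂ⟦X⟧ →ₗ[ℂ] ℂ⟦X⟧ := funJ0 l fun t => q ^ (a * t)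

/-- The raising operator `J₊ = x [J₀ + l]_q`. -/
def Jplus (q l : ℝ) : ℂ⟦X⟧ →ₗ[ℂ] ℂ⟦X⟧ := mulX ∘ₗ funJ0 l fun t => qNum q (t + l)

/-- The lowering operator `J₋ = x⁻¹ [J₀ - l]_q`. -/
def Jminus (q l : ℝ) : ℂ⟦X⟧ →ₗ[ℂ] ℂ⟦X⟧ := divX ∘ₗ funJ0 l fun t => qNum q (t - l)

/-- The formal operator `I₃ = -½ q^{-3J₀/4} (J₊ + J₋) q^{-3J₀/4}
  + (1+q)/(2(1-q)) q^{-2J₀} - (q^l + q^{1-l})/(2(1-q)) q^{-J₀}`. -/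
def I3Formal (q l : ℝ) : ℂ⟦X⟧ →ₗ[ℂ] ℂ⟦X⟧ :=
  -((1 / 2 : ℂ) •
      (qPowJ0 q l (-(3 / 4)) ∘ₗ (Jplus q l + Jminus q l) ∘ₗ qPowJ0 q l (-(3 / 4))))
    + (((1 + q) / (2 * (1 - q)) : ℝ) : ℂ) • qPowJ0 q l (-2)
    - (((q ^ l + q ^ (1 - l)) / (2 * (1 - q)) : ℝ) : ℂ) • qPowJ0 q l (-1)

/-! ### The Hilbert space -/

/-- The Hilbert space of all series `∑ b_n f_n` with `∑ |b_n|² < ∞`, where the functions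
`f_n = c_n x^n` form an orthonormal basis, in the coordinates `(b_n)`. -/
abbrev Hl : Type := lp (fun _ : ℕ => ℂ) 2

/-- The orthonormal basis element `f_n`. -/
def basisVec (n : ℕ) : Hl := lp.single 2 n (1 : ℂ)

/-- The power series `∑ b_n c_n x^n` in `x` that an element `(b_n)` of the Hilbert space
stands for. -/
def toSeries (q l : ℝ) : Hl →ₗ[ℂ] ℂ⟦X⟧ where
  toFun b := PowerSeries.mk fun n => b n * (normConst q l n : ℂ)
  map_add' b d := by ext n; simp [add_mul]
  map_smul' a b := by ext n; simp [mul_assoc]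

/-- The polynomials, as a linear subspace of the Hilbert space. -/
def polySubspace (q l : ℝ) : Submodule ℂ Hl :=
  (LinearMap.range (Polynomial.coeToPowerSeries.algHom (R := ℂ) ℂ).toLinearMap).comap
    (toSeries q l)

theorem coeff_I3Formal_eq_zero (q l : ℝ) (f : ℂ⟦X⟧) (N : ℕ)
    (hf : ∀ n, N ≤ n → PowerSeries.coeff n f = 0) (n : ℕ) (hn : N + 1 ≤ n) :
    PowerSeries.coeff n (I3Formal q l f) = 0 := by
  obtain ⟨m, rfl⟩ : ∃ m, n = m + 1 := ⟨n - 1, by omega⟩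
  have h0 := hf m (by omega)
  have h1 := hf (m + 1) (by omega)
  have h2 := hf (m + 1 + 1) (by omega)
  simp [I3Formal, qPowJ0, Jplus, Jminus, funJ0, mulX, divX, PowerSeries.coeff_succ_X_mul,
    h0, h1, h2]

theorem memlp_I3 (q l : ℝ) (b : polySubspace q l) :
    Memℓp (fun n => PowerSeries.coeff n (I3Formal q l (toSeries q l b)) /
      (normConst q l n : ℂ)) 2 := by
  obtain ⟨b, p, hp⟩ := b
  have hc : ∀ n, p.natDegree + 1 ≤ n → PowerSeries.coeff n (toSeries q l b) = 0 := by
    intro n hn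
    rw [← hp]
    simpa using Polynomial.coeff_eq_zero_of_natDegree_lt (p := p) (n := n) (by omega)
  refine (memℓp_zero (Set.Finite.subset (Set.finite_lt_nat (p.natDegree + 1 + 1)) ?_)).of_exponent_ge
    (zero_le)
  intro n hn
  by_contra hlt
  exact hn (by simp [coeff_I3Formal_eq_zero q l _ _ hc n (by simpa using hlt)])

/-- The operator `I₃` on the Hilbert space, with the polynomials as its domain (not yet
closed): the coordinates of `I₃ f` are the coefficients of `I₃ f` divided by `c_n`. -/
def I3 (q l : ℝ) : Hl →ₗ.[ℂ] Hl where
  domain := polySubspace q l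
  toFun :=
    { toFun := fun b => ⟨_, memlp_I3 q l b⟩
      map_add' := fun b d => by
        ext n
        simp [add_div]
        rfl
      map_smul' := fun a b => by ext n; simp [mul_div_assoc] }

/-- The closed operator `I₃`. -/
def I3Closed (q l : ℝ) : Hl →ₗ.[ℂ] Hl := (I3 q l).closure

/-- The dimension of `ker (T* - z)`. For `z = i` and `z = -i` these are the two deficiency
indices of a closed symmetric operator `T`. -/
def deficiencyIndex (T : Hl →ₗ.[ℂ] Hl) (z : ℂ) : Cardinal :=
  Module.rank ℂ (LinearMap.ker (T†.toFun - z • T†.domain.subtype))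

/-! ### The eigenfunctions -/

/-- The coefficients
`P_n(λ) = q^{n/2} (q;q)_n^{1/2} / (q^{2l};q)_n^{1/2} L_n^{(2l-1)}(2(1-q)λ; q)`. -/
def overlap (q l : ℝ) (n : ℕ) (lam : ℂ) : ℂ :=
  ((q ^ ((n : ℝ) / 2) * (√(qPoch q q n) / √(qPoch (q ^ (2 * l)) q n)) : ℝ) : ℂ) *
    qLaguerre q (2 * l - 1) n (2 * (1 - q) * lam)

/-- The formal series `ζ_λ = ∑ P_n(λ) f_n = ∑ P_n(λ) c_n x^n`. -/
def eigenSeries (q l : ℝ) (lam : ℂ) : ℂ⟦X⟧ :=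
  PowerSeries.mk fun n => overlap q l n lam * (normConst q l n : ℂ)

end QSU11

end

/-! In the basis `f_n` the operator `I₃` is a real symmetric tridiagonal (Jacobi) matrix. Pairing a
vector `v` with `I₃ f_n` reads off the `n`-th coordinate of the formal series `I₃ v`, so the adjoint
is the formal operator on its maximal domain (`I3Formal_toSeries_eq_iff`). Hence `ker (I₃* - λ)`
consists of the formal eigenseries with square-summable coordinates.

The formal eigenvalue equation is a three-term recurrence with nonvanishing off-diagonal entries, so
its solutions form a line (`I3Formal_eq_smul_iff`). After rescaling it is the recurrence of the
`q`-Laguerre polynomials. That recurrence and the generating function `₁φ₁ / (t;q)_∞` both come from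
writing `L_n` as a coefficient of Euler's series times `₁φ₁` (`qLaguerre_eq_coeff`). The generating
series converges absolutely for `|t| < 1`, and the weight `q^{n/2}` in `P_n` then makes `∑ |P_n(λ)|`
finite for every complex `λ` (`summable_norm_overlap`).

Thus every `λ ∈ ℂ` is a simple eigenvalue of the adjoint. The values `±i` give deficiency indices
`(1,1)` and rule out selfadjointness; large real `λ` rule out boundedness. The `P_n` have real
coefficients, so `ζ_i` and `ζ_{-i}` have equal norm, and von Neumann's construction yields a
different selfadjoint extension for each point of the unit circle
(`infinite_selfAdjoint_extensions`). -/

namespace QSU11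

/-! ### Von Neumann's extension theory for deficiency indices `(1,1)`. -/

section SelfAdjointExtensions

variable {H : Type*} [NormedAddCommGroup H] [InnerProductSpace ℂ H]
  {S : H →ₗ.[ℂ] H}

/-- Symmetry makes `⟨S f, f⟩` real, so the cross term, being the real part of `i` times a real
number, vanishes. -/
theorem norm_sq_sub_I_smul (hs : S.IsFormalAdjoint S) (f : S.domain) :
    ‖S f - Complex.I • (f : H)‖ ^ 2 = ‖S f‖ ^ 2 + ‖(f : H)‖ ^ 2 := by
  have h1 : inner ℂ (S f) (f : H) = inner ℂ (f : H) (S f) := hs f f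
  have him : (inner ℂ (S f) (f : H)).im = 0 := by
    rw [← Complex.conj_eq_iff_im, inner_conj_symm, h1]
  rw [@norm_sub_sq ℂ, norm_smul, inner_smul_right]
  simp [him]

variable [CompleteSpace H]

/-- Membership in the graph of the adjoint, by testing against the operator. -/
theorem exists_adjoint_eq (hd : Dense (S.domain : Set H)) {v w : H}
    (h : ∀ x : S.domain, inner ℂ w (x : H) = inner ℂ v (S x)) :
    ∃ hv : v ∈ S†.domain, S† ⟨v, hv⟩ = w :=
  ⟨LinearPMap.mem_adjoint_domain_of_exists v ⟨w, h⟩, LinearPMap.adjoint_apply_eq hd _ h⟩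

/-- The range of `S - i` is closed when `S` is closed and symmetric. -/
theorem isClosed_range_sub_I (hs : S.IsFormalAdjoint S) (hc : S.IsClosed) :
    IsClosed (LinearMap.range (S.toFun - Complex.I • S.domain.subtype) : Set H) := by
  let L : S.graph →L[ℂ] H :=
    (ContinuousLinearMap.snd ℂ H H - Complex.I • ContinuousLinearMap.fst ℂ H H) ∘L
      S.graph.subtypeL
  have hcomp : CompleteSpace S.graph := IsClosed.completeSpace_coe (hs := hc)
  -- On the graph, which is complete, the map `(x, y) ↦ y - i x` is bounded below by the Pythagorean
  -- identity, and such a map has closed range.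
  have hL : AntilipschitzWith 1 L := by
    refine L.antilipschitz_of_bound fun x => ?_
    obtain ⟨⟨x, y⟩, hxy⟩ := x
    obtain ⟨f, rfl, rfl⟩ := S.mem_graph_iff.1 hxy
    have h := norm_sq_sub_I_smul hs f
    have h0 : L ⟨((f : H), S f), hxy⟩ = S f - Complex.I • (f : H) := rfl
    rw [h0, NNReal.coe_one, one_mul, Submodule.coe_norm, Prod.norm_def]
    refine max_le ?_ ?_ <;> refine le_of_sq_le_sq ?_ (norm_nonneg _) <;> simp only [h] <;>
      nlinarith [sq_nonneg ‖(f : H)‖, sq_nonneg ‖S f‖]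
  have hcl := hL.isClosed_range L.uniformContinuous
  convert hcl using 1
  ext y
  constructor
  · rintro ⟨f, rfl⟩
    exact ⟨⟨((f : H), S f), S.mem_graph f⟩, rfl⟩
  · rintro ⟨⟨⟨x, y⟩, hxy⟩, rfl⟩
    obtain ⟨f, rfl, rfl⟩ := S.mem_graph_iff.1 hxy
    exact ⟨f, rfl⟩

/-- Von Neumann's decomposition of the domain of the adjoint of a closed symmetric operator. -/
theorem exists_add_add_of_mem_adjoint_domain (hd : Dense (S.domain : Set H))
    (hs : S.IsFormalAdjoint S) (hc : S.IsClosed) (v : S†.domain) :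
    ∃ (f : S.domain) (m n : S†.domain), (v : H) = f + m + n ∧
      S† m = Complex.I • (m : H) ∧ S† n = -Complex.I • (n : H) := by
  have hle : S ≤ S† := hs.le_adjoint hd
  set K := LinearMap.range (S.toFun - Complex.I • S.domain.subtype)
  have : CompleteSpace K := IsClosed.completeSpace_coe (hs := isClosed_range_sub_I hs hc)
  obtain ⟨k, ⟨f, rfl⟩, n, hn, hkn⟩ :=
    K.exists_add_mem_mem_orthogonal (S† v - Complex.I • (v : H))
  obtain ⟨hn1, hn2⟩ := exists_adjoint_eq hd (v := n) (w := -Complex.I • n) (S := S) (by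
    intro x
    have h := (K.mem_orthogonal' n).1 hn _ ⟨x, rfl⟩
    have h' : inner ℂ n (S x - Complex.I • (x : H)) = 0 := h
    rw [inner_sub_right, inner_smul_right, sub_eq_zero] at h'
    simp [inner_smul_left, h'])
  let f' : S†.domain := ⟨f, hle.1 f.2⟩
  have hf' : S† f' = S f := (hle.2 (x := f) (y := f') rfl).symm
  let n' : S†.domain := ⟨n, hn1⟩
  -- Since `S† n = -i n`, the operator `S† - i` multiplies `n` by `-2i`. The factor `i/2` therefore
  -- makes it send `(i/2) n` to `n`, which leaves `v - f - (i/2) n` in its kernel.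
  refine ⟨f, v - f' - (Complex.I / 2) • n', (Complex.I / 2) • n', ?_, ?_, ?_⟩
  · simp only [AddSubgroupClass.coe_sub, f']; abel
  · rw [LinearPMap.map_sub, LinearPMap.map_sub, LinearPMap.map_smul, hf', hn2]
    have hkn' : S† v = (S f - Complex.I • (f : H) + n) + Complex.I • (v : H) := by
      rw [← sub_eq_iff_eq_add, hkn]; rfl
    rw [hkn']
    have hI : Complex.I / 2 * Complex.I = -(1 / 2) := by
      rw [div_mul_eq_mul_div, Complex.I_mul_I]; norm_num
    have hI' : Complex.I * (Complex.I / 2) = -(1 / 2) := by rw [mul_comm, hI]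
    simp only [AddSubgroupClass.coe_sub, SetLike.val_smul, smul_sub, smul_smul, smul_neg, f', n', hI', hI,
      neg_smul]
    module
  · rw [LinearPMap.map_smul, hn2]
    simp [n', smul_smul, mul_comm]

/-- A closed symmetric operator whose two deficiency spaces are spanned by vectors of equal
nonzero norm has infinitely many selfadjoint extensions. -/
theorem infinite_selfAdjoint_extensions (hd : Dense (S.domain : Set H))
    (hs : S.IsFormalAdjoint S) (hc : S.IsClosed) (u v : S†.domain)
    (hu : S† u = Complex.I • (u : H)) (hv : S† v = -Complex.I • (v : H))
    (hu' : ∀ m : S†.domain, S† m = Complex.I • (m : H) → ∃ a : ℂ, m = a • u)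
    (hv' : ∀ m : S†.domain, S† m = -Complex.I • (m : H) → ∃ a : ℂ, m = a • v)
    (hu0 : (u : H) ≠ 0) (huv : ‖(u : H)‖ = ‖(v : H)‖) :
    {T : H →ₗ.[ℂ] H | IsSelfAdjoint T ∧ S ≤ T}.Infinite := by
  have hle : S ≤ S† := hs.le_adjoint hd
  have hadj := LinearPMap.adjoint_isFormalAdjoint hd
  -- The extension attached to `w` is `S†` restricted to `dom S + ℂ e(w)`. The boundary form `⟨S† x,
  -- y⟩ - ⟨x, S† y⟩` vanishes as soon as one argument lies in `dom S`, so only its values on the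
  -- span of `u` and `v` matter.
  let e (w : Circle) : S†.domain := u + (w : ℂ) • v
  have he (w : Circle) : S† (e w) = Complex.I • (u : H) - (Complex.I * w) • (v : H) := by
    simp only [e]
    rw [LinearPMap.map_add, LinearPMap.map_smul, hu, hv, smul_smul]
    module
  let D (w : Circle) : Submodule ℂ H := S.domain ⊔ ℂ ∙ (e w : H)
  have hDle (w : Circle) : D w ≤ S†.domain :=
    sup_le hle.1 ((Submodule.span_singleton_le_iff_mem _ _).2 (e w).2)
  let T (w : Circle) : H →ₗ.[ℂ] H := S†.domRestrict (D w)
  have hTdom (w : Circle) : (T w).domain = D w := inf_eq_left.2 (hDle w)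
  have hTS (w : Circle) : T w ≤ S† := LinearPMap.domRestrict_le
  have hST (w : Circle) : S ≤ T w := by
    refine ⟨(hTdom w).symm ▸ le_sup_left, fun x y hxy => ?_⟩
    rw [(hTS w).2 (x := y) (y := ⟨x, hle.1 x.2⟩) hxy.symm]
    exact hle.2 rfl
  have hmem (w : Circle) (x : H) (hx : x ∈ (T w).domain) :
      ∃ (f : S.domain) (a : ℂ), x = f + a • (e w : H) := by
    rw [hTdom, Submodule.mem_sup] at hx
    obtain ⟨f, hf, y, hy, rfl⟩ := hx
    obtain ⟨a, rfl⟩ := Submodule.mem_span_singleton.1 hy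
    exact ⟨⟨f, hf⟩, a, rfl⟩
  have heT (w : Circle) : (e w : H) ∈ (T w).domain := by
    rw [hTdom]; exact Submodule.mem_sup_right (Submodule.mem_span_singleton_self _)
  have hdT (w : Circle) : Dense ((T w).domain : Set H) := hd.mono (hST w).1
  have hSapp (f : S.domain) (h : (f : H) ∈ S†.domain) : S† ⟨f, h⟩ = S f :=
    (hle.2 (x := f) (y := ⟨f, h⟩) rfl).symm
  -- the boundary form on the deficiency spaces
  have hform (a b : ℂ) (w : Circle) :
      inner ℂ (Complex.I • a • (u : H) - Complex.I • b • (v : H)) (e w : H)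
        - inner ℂ (a • (u : H) + b • (v : H)) (S† (e w))
      = -2 * Complex.I * ‖(u : H)‖ ^ 2 * (starRingEnd ℂ a - starRingEnd ℂ b * w) := by
    rw [he]
    simp only [e, Submodule.coe_add, SetLike.val_smul, inner_add_left,
      inner_sub_left, inner_add_right, inner_sub_right, inner_smul_left, inner_smul_right,
      inner_self_eq_norm_sq_to_K, Complex.conj_I, ← huv]
    simp only [Complex.coe_algebraMap]
    ring
  have hsymm (w : Circle) : (T w).IsFormalAdjoint (T w) := by
    rintro ⟨x, hx⟩ ⟨y, hy⟩
    rw [(hTS w).2 (x := ⟨x, hx⟩) (y := ⟨x, (hTS w).1 hx⟩) rfl,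
      (hTS w).2 (x := ⟨y, hy⟩) (y := ⟨y, (hTS w).1 hy⟩) rfl]
    obtain ⟨f, a, rfl⟩ := hmem w x hx
    obtain ⟨g, b, rfl⟩ := hmem w y hy
    let f' : S†.domain := ⟨f, hle.1 f.2⟩
    let g' : S†.domain := ⟨g, hle.1 g.2⟩
    have hx' : S† ⟨f + a • (e w : H), (hTS w).1 hx⟩ = S f + a • S† (e w) := by
      rw [← hSapp f f'.2, ← LinearPMap.map_smul, ← LinearPMap.map_add]; rfl
    have hy' : S† ⟨g + b • (e w : H), (hTS w).1 hy⟩ = S g + b • S† (e w) := by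
      rw [← hSapp g g'.2, ← LinearPMap.map_smul, ← LinearPMap.map_add]; rfl
    have h1 : inner ℂ (S f) (e w : H) = inner ℂ (f : H) (S† (e w)) := hadj.symm f (e w)
    have h2 : inner ℂ (S† (e w)) (g : H) = inner ℂ (e w : H) (S g) := hadj (e w) g
    have h3 : inner ℂ (S† (e w)) (e w : H) = inner ℂ (e w : H) (S† (e w)) := by
      have h := hform 1 w w
      have hw : starRingEnd ℂ (w : ℂ) * w = 1 := by
        rw [← Complex.normSq_eq_conj_mul_self]; simp
      rw [map_one, hw, sub_self, mul_zero, sub_eq_zero] at h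
      rw [he w] at h ⊢
      simpa [e, smul_smul, sub_eq_add_neg] using h
    simp only [hx', hy', inner_add_left, inner_add_right, inner_smul_left, inner_smul_right,
      h1, h2, h3, hs f g]
  have hsa (w : Circle) : IsSelfAdjoint (T w) := by
    rw [LinearPMap.isSelfAdjoint_def]
    refine le_antisymm ?_ ((hsymm w).le_adjoint (hdT w))
    have hadjT := LinearPMap.adjoint_isFormalAdjoint (hdT w)
    have key (x : (T w)†.domain) : ∃ hx : (x : H) ∈ S†.domain, S† ⟨x, hx⟩ = (T w)† x := by
      refine exists_adjoint_eq hd fun f => ?_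
      rw [hadjT x ⟨f, (hST w).1 f.2⟩]
      congr 1
      exact ((hST w).2 rfl).symm
    -- A vector `f + a u + b v` in the domain of the adjoint has zero boundary form against `e(w)`.
    -- This forces `b = a w`, which puts the vector in `dom S + ℂ e(w)`.
    have hdom : (T w)†.domain ≤ (T w).domain := by
      intro x hx
      obtain ⟨hx1, hx2⟩ := key ⟨x, hx⟩
      obtain ⟨f, m, n, hx3, hm, hn⟩ :=
        exists_add_add_of_mem_adjoint_domain hd hs hc ⟨x, hx1⟩
      obtain ⟨a, rfl⟩ := hu' m hm
      obtain ⟨b, rfl⟩ := hv' n hn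
      have hx4 : S† ⟨x, hx1⟩ = S f + (Complex.I • a • (u : H) - Complex.I • b • (v : H)) := by
        have : (⟨x, hx1⟩ : S†.domain) = ⟨f, hle.1 f.2⟩ + a • u + b • v := Subtype.ext hx3
        rw [this, LinearPMap.map_add, LinearPMap.map_add, hSapp, hm, hn]
        simp only [SetLike.val_smul]
        module
      have hx5 := hadjT ⟨x, hx⟩ ⟨e w, heT w⟩
      rw [← hx2, (hTS w).2 (x := ⟨e w, heT w⟩) (y := e w) rfl, hx4] at hx5
      change inner ℂ _ (e w : H) = inner ℂ x _ at hx5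
      have hx3' : x = f + (a • (u : H) + b • (v : H)) := by rw [← add_assoc]; exact hx3
      rw [hx3', inner_add_left, inner_add_left, hadj.symm f (e w), add_right_inj, ← sub_eq_zero,
        hform] at hx5
      have hn0 : (-2 * Complex.I * ‖(u : H)‖ ^ 2 : ℂ) ≠ 0 := by
        simp [hu0]
      have hab := sub_eq_zero.1 ((mul_eq_zero.1 hx5).resolve_left hn0)
      have hba : b = a * w := by
        have h1 := congrArg (starRingEnd ℂ) hab
        simp only [Complex.conj_conj, map_mul] at h1
        have hw : starRingEnd ℂ (w : ℂ) * w = 1 := by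
          rw [← Complex.normSq_eq_conj_mul_self]; simp
        rw [h1, mul_assoc, hw, mul_one]
      rw [hTdom, hx3', hba]
      refine Submodule.add_mem_sup f.2 (Submodule.mem_span_singleton.2 ⟨a, ?_⟩)
      simp [e, smul_smul]
    refine ⟨hdom, fun x y hxy => ?_⟩
    obtain ⟨hx1, hx2⟩ := key x
    rw [← hx2]
    exact ((hTS w).2 hxy.symm).symm
  have hinj : Function.Injective T := by
    intro w w' h
    -- If `e(w)` and `e(w')` lie in the domain of one symmetric extension, their boundary form
    -- vanishes, which reads `conj w * w' = 1`.
    have hmem' : (e w : H) ∈ (T w').domain := h ▸ heT w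
    have h1 := hsymm w' ⟨e w, hmem'⟩ ⟨e w', heT w'⟩
    rw [(hTS w').2 (x := ⟨e w, hmem'⟩) (y := e w) rfl,
      (hTS w').2 (x := ⟨e w', heT w'⟩) (y := e w') rfl] at h1
    change inner ℂ _ (e w' : H) = inner ℂ (e w : H) _ at h1
    have h2 := hform 1 w w'
    have h3 : Complex.I • (1 : ℂ) • (u : H) - Complex.I • (w : ℂ) • (v : H) = S† (e w) := by
      rw [he, one_smul, smul_smul]
    have h4 : (1 : ℂ) • (u : H) + (w : ℂ) • (v : H) = e w := by simp [e]
    have hn0 : (-2 * Complex.I * ‖(u : H)‖ ^ 2 : ℂ) ≠ 0 := by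
      simp [hu0]
    rw [h3, h4, h1, sub_self, eq_comm, mul_eq_zero, or_iff_right hn0, map_one, sub_eq_zero] at h2
    have hw : starRingEnd ℂ (w : ℂ) * w = 1 := by
      rw [← Complex.normSq_eq_conj_mul_self]; simp
    apply Circle.ext
    calc (w : ℂ) = w * (starRingEnd ℂ (w : ℂ) * w') := by rw [← h2, mul_one]
      _ = (starRingEnd ℂ (w : ℂ) * w) * w' := by ring
      _ = w' := by rw [hw, one_mul]
  have : Infinite Circle :=
    have := (Set.Ioc_infinite (by linarith [Real.pi_pos] : -Real.pi < Real.pi)).to_subtype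
    Circle.argEquiv.infinite_iff.2 this
  exact (Set.infinite_range_of_injective hinj).mono
    (Set.range_subset_iff.2 fun w => ⟨hsa w, hST w⟩)

end SelfAdjointExtensions

/-! ### The Jacobi matrix of `I₃`. -/

section Jacobi

theorem qNum_eq {q : ℝ} (hq0 : 0 < q) (hq1 : q < 1) (a : ℝ) :
    qNum q a = q ^ ((1 - a) / 2) * (1 - q ^ a) / (1 - q) := by
  have h1 : q ^ (-(1 / 2) : ℝ) * (1 - q) ≠ 0 := by
    have := Real.rpow_pos_of_pos hq0 (-(1 / 2) : ℝ)
    have : (1 - q) ≠ 0 := by linarith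
    positivity
  have h2 : q ^ (1 / 2 : ℝ) - q ^ (-(1 / 2 : ℝ)) = -(q ^ (-(1 / 2) : ℝ) * (1 - q)) := by
    rw [mul_sub, mul_one, ← Real.rpow_add_one hq0.ne']
    norm_num
  have h3 : q ^ (a / 2) - q ^ (-(a / 2)) = -(q ^ (-(a / 2)) * (1 - q ^ a)) := by
    rw [mul_sub, mul_one, ← Real.rpow_add hq0]
    ring_nf
  have h4 : q ^ (-(a / 2)) = q ^ ((1 - a) / 2) * q ^ (-(1 / 2) : ℝ) := by
    rw [← Real.rpow_add hq0]; ring_nf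
  rw [qNum, h2, h3, neg_div_neg_eq, h4]
  field_simp

theorem qNum_pos {q : ℝ} (hq0 : 0 < q) (hq1 : q < 1) {a : ℝ} (ha : 0 < a) : 0 < qNum q a := by
  rw [qNum_eq hq0 hq1]
  have := Real.rpow_lt_one hq0.le hq1 ha
  have := Real.rpow_pos_of_pos hq0 ((1 - a) / 2)
  exact div_pos (mul_pos this (by linarith)) (by linarith)

variable {q l : ℝ}

theorem normConst_pos (hq0 : 0 < q) (hq1 : q < 1) (hl : 0 < l) (n : ℕ) : 0 < normConst q l n :=
  Finset.prod_pos fun k _ => div_pos (Real.sqrt_pos.2 (qNum_pos hq0 hq1 (by positivity)))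
    (Real.sqrt_pos.2 (qNum_pos hq0 hq1 (by positivity)))

theorem normConst_ne_zero (hq0 : 0 < q) (hq1 : q < 1) (hl : 0 < l) (n : ℕ) :
    (normConst q l n : ℂ) ≠ 0 :=
  Complex.ofReal_ne_zero.2 (normConst_pos hq0 hq1 hl n).ne'

theorem normConst_succ (n : ℕ) : normConst q l (n + 1) =
    normConst q l n * (√(qNum q (2 * l + n)) / √(qNum q (n + 1))) :=
  Finset.prod_range_succ _ _

/-- The off-diagonal entries of the Jacobi matrix of `I₃` in the basis `f_n`. -/
noncomputable def offDiag (q l : ℝ) (n : ℕ) : ℝ :=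
  -(1 / 2) * q ^ (-(3 / 4) * (l + n)) * q ^ (-(3 / 4) * (l + (n + 1))) *
    (√(qNum q (2 * l + n)) * √(qNum q (n + 1)))

/-- The diagonal entries of the Jacobi matrix of `I₃` in the basis `f_n`. -/
noncomputable def diag (q l : ℝ) (n : ℕ) : ℝ :=
  (1 + q) / (2 * (1 - q)) * q ^ (-2 * (l + n)) -
    (q ^ l + q ^ (1 - l)) / (2 * (1 - q)) * q ^ (-1 * (l + n))

theorem coeff_zero_I3Formal (f : ℂ⟦X⟧) : PowerSeries.coeff 0 (I3Formal q l f) =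
    -(1 / 2) * ((q ^ (-(3 / 4) * l) * qNum q 1 * q ^ (-(3 / 4) * (l + 1)) : ℝ) : ℂ) *
      PowerSeries.coeff 1 f + (diag q l 0 : ℂ) * PowerSeries.coeff 0 f := by
  simp [I3Formal, qPowJ0, Jplus, Jminus, funJ0, mulX, divX, diag]
  ring

theorem coeff_succ_I3Formal (f : ℂ⟦X⟧) (n : ℕ) : PowerSeries.coeff (n + 1) (I3Formal q l f) =
    -(1 / 2) * ((q ^ (-(3 / 4) * (l + (n + 1))) * qNum q (2 * l + n) *
      q ^ (-(3 / 4) * (l + n)) : ℝ) : ℂ) * PowerSeries.coeff n f +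
    (diag q l (n + 1) : ℂ) * PowerSeries.coeff (n + 1) f +
    -(1 / 2) * ((q ^ (-(3 / 4) * (l + (n + 1))) * qNum q (n + 1 + 1) *
      q ^ (-(3 / 4) * (l + (n + 1 + 1))) : ℝ) : ℂ) * PowerSeries.coeff (n + 1 + 1) f := by
  have h1 : l + n + l = 2 * l + n := by ring
  simp [I3Formal, qPowJ0, Jplus, Jminus, funJ0, mulX, divX, diag, PowerSeries.coeff_succ_X_mul,
    h1]
  ring

theorem coeff_toSeries (b : Hl) (n : ℕ) :
    PowerSeries.coeff n (toSeries q l b) = b n * (normConst q l n : ℂ) := by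
  simp [toSeries]

theorem toSeries_injective (hq0 : 0 < q) (hq1 : q < 1) (hl : 0 < l) :
    Function.Injective (toSeries q l) := by
  intro b d h
  ext n
  have h1 := congrArg (PowerSeries.coeff n) h
  rw [coeff_toSeries, coeff_toSeries] at h1
  exact mul_right_cancel₀ (normConst_ne_zero hq0 hq1 hl n) h1

theorem coeff_zero_I3Formal_toSeries (hq0 : 0 < q) (hq1 : q < 1) (b : Hl) :
    PowerSeries.coeff 0 (I3Formal q l (toSeries q l b)) / (normConst q l 0 : ℂ) =
      diag q l 0 * b 0 + offDiag q l 0 * b 1 := by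
  have h1 := Real.sq_sqrt (qNum_pos hq0 hq1 one_pos).le
  have h2 := Real.sqrt_pos.2 (qNum_pos hq0 hq1 one_pos)
  have h3 : normConst q l 1 * qNum q 1 = √(qNum q (2 * l)) * √(qNum q 1) := by
    rw [normConst_succ]
    simp only [normConst, Finset.range_zero, Finset.prod_empty, Nat.cast_zero, add_zero, zero_add]
    rw [one_mul, div_mul_eq_mul_div, div_eq_iff h2.ne']
    linear_combination (-√(qNum q (2 * l))) * h1
  rw [coeff_zero_I3Formal, coeff_toSeries, coeff_toSeries]
  have h0 : normConst q l 0 = 1 := by simp [normConst]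
  have h4 : offDiag q l 0 = -(1 / 2) * q ^ (-(3 / 4) * l) * q ^ (-(3 / 4) * (l + 1)) *
      (normConst q l 1 * qNum q 1) := by
    rw [h3]; simp [offDiag]
  rw [h0, h4]
  push_cast
  ring

/-- The ratio `c_{n+1} / c_n = √[2l+n] / √[n+1]` balances the raising weight `[2l+n]` against the
lowering weight `[n+1]`: both become `√[2l+n] √[n+1]`, so the matrix is symmetric. -/
theorem coeff_succ_I3Formal_toSeries (hq0 : 0 < q) (hq1 : q < 1) (hl : 0 < l) (b : Hl) (n : ℕ) :
    PowerSeries.coeff (n + 1) (I3Formal q l (toSeries q l b)) / (normConst q l (n + 1) : ℂ) =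
      offDiag q l n * b n + diag q l (n + 1) * b (n + 1) + offDiag q l (n + 1) * b (n + 2) := by
  have p1 : 0 < qNum q (2 * l + n) := qNum_pos hq0 hq1 (by positivity)
  have p2 : 0 < qNum q (n + 1) := qNum_pos hq0 hq1 (by positivity)
  have p3 : 0 < qNum q (n + 1 + 1) := qNum_pos hq0 hq1 (by positivity)
  have s1 := Real.sqrt_pos.2 p1
  have s2 := Real.sqrt_pos.2 p2
  have s3 := Real.sqrt_pos.2 p3
  have t1 := Real.sq_sqrt p1.le
  have t3 := Real.sq_sqrt p3.le
  have hn := normConst_pos hq0 hq1 hl n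
  have hn' := normConst_pos hq0 hq1 hl (n + 1)
  have h1 : qNum q (2 * l + n) * normConst q l n =
      √(qNum q (2 * l + n)) * √(qNum q (n + 1)) * normConst q l (n + 1) := by
    rw [normConst_succ]
    nth_rw 1 [← t1]
    field_simp
  have h3 : qNum q (n + 1 + 1) * normConst q l (n + 1 + 1) =
      √(qNum q (2 * l + (n + 1))) * √(qNum q (n + 1 + 1)) * normConst q l (n + 1) := by
    rw [normConst_succ (n + 1)]
    push_cast
    nth_rw 1 [← t3]
    field_simp
  have h1' := congrArg (fun x : ℝ => (x : ℂ)) h1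
  have h3' := congrArg (fun x : ℝ => (x : ℂ)) h3
  rw [coeff_succ_I3Formal, coeff_toSeries, coeff_toSeries, coeff_toSeries,
    div_eq_iff (normConst_ne_zero hq0 hq1 hl (n + 1)), offDiag, offDiag]
  push_cast at h1' h3' ⊢
  linear_combination (-(1 / 2) * ((q ^ (-(3 / 4) * (l + (n + 1))) : ℝ) : ℂ) *
      ((q ^ (-(3 / 4) * (l + n)) : ℝ) : ℂ) * b n) * h1' +
    (-(1 / 2) * ((q ^ (-(3 / 4) * (l + (n + 1))) : ℝ) : ℂ) *
      ((q ^ (-(3 / 4) * (l + (n + 1 + 1))) : ℝ) : ℂ) * b (n + 1 + 1)) * h3'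

end Jacobi

/-! ### `q`-difference equations and two expansions of the `q`-Laguerre polynomials. -/

section FormalSeries

open PowerSeries

theorem qPoch_zero {R : Type*} [CommRing R] (a q : R) : qPoch a q 0 = 1 := by simp [qPoch]

theorem qPoch_succ {R : Type*} [CommRing R] (a q : R) (n : ℕ) :
    qPoch a q (n + 1) = qPoch a q n * (1 - a * q ^ n) := Finset.prod_range_succ _ _

variable {K : Type*} [Field K] {q A y : K}

/-- Euler's series `∑ tⁿ / (q;q)_n`. -/
noncomputable def eulerSeries (q : K) : K⟦X⟧ := mk fun n => (qPoch q q n)⁻¹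

/-- The terms of `₁φ₁(-y; 0; q; A t)`. -/
noncomputable def phiSeries (q A y : K) : K⟦X⟧ :=
  mk fun k => qPoch (-y) q k * ((-1) ^ k * q ^ (k * (k - 1) / 2)) * A ^ k / qPoch q q k

/-- The terms of `₀φ₁(A; q; -y A t)`. -/
noncomputable def besselSeries (q A y : K) : K⟦X⟧ :=
  mk fun k => (-y) ^ k * q ^ (k * (k - 1)) * A ^ k / (qPoch A q k * qPoch q q k)

theorem one_sub_X_mul_eulerSeries (hq : ∀ n, qPoch q q n ≠ 0) :
    (1 - X) * eulerSeries q = rescale q (eulerSeries q) := by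
  ext n
  rw [sub_mul, one_mul, map_sub, coeff_rescale]
  rcases n with _ | n
  · simp
  · have h := hq (n + 1)
    have h' := hq n
    rw [coeff_succ_X_mul, eulerSeries, coeff_mk, coeff_mk]
    rw [qPoch_succ] at h ⊢
    have h2 : 1 - q * q ^ n ≠ 0 := right_ne_zero_of_mul h
    field_simp
    ring

theorem coeff_phiSeries_succ (hq : ∀ n, qPoch q q n ≠ 0) (k : ℕ) :
    coeff (k + 1) (phiSeries q A y) * (1 - q ^ (k + 1)) =
      -A * (q ^ k + y * (q ^ k) ^ 2) * coeff k (phiSeries q A y) := by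
  have h := hq (k + 1)
  have h' := hq k
  rw [phiSeries, coeff_mk, coeff_mk, Nat.triangle_succ]
  rw [qPoch_succ] at h
  rw [qPoch_succ, qPoch_succ]
  have h2 : 1 - q * q ^ k ≠ 0 := right_ne_zero_of_mul h
  rw [← pow_succ'] at h2 ⊢
  field_simp
  ring

theorem coeff_besselSeries_succ (hq : ∀ n, qPoch q q n ≠ 0) (hA : ∀ n, qPoch A q n ≠ 0) (k : ℕ) :
    coeff (k + 1) (besselSeries q A y) * ((1 - q ^ (k + 1)) * (1 - A * q ^ k)) =
      -A * y * (q ^ k) ^ 2 * coeff k (besselSeries q A y) := by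
  have h := hq (k + 1)
  have h' := hq k
  have g := hA (k + 1)
  have g' := hA k
  have e : (k + 1) * (k + 1 - 1) = k * (k - 1) + k + k := by
    cases k <;> simp; ring
  rw [besselSeries, coeff_mk, coeff_mk, e]
  rw [qPoch_succ] at h g
  rw [qPoch_succ, qPoch_succ]
  have h2 : 1 - q * q ^ k ≠ 0 := right_ne_zero_of_mul h
  have g2 : 1 - A * q ^ k ≠ 0 := right_ne_zero_of_mul g
  rw [← pow_succ'] at h2 ⊢
  field_simp
  ring

/-- This is the coefficient recursion as a `q`-difference equation: a factor `q^k` on the `k`-th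
coefficient amounts to `t ↦ q t`, which is `rescale q`. -/
theorem phiSeries_eq (hq : ∀ n, qPoch q q n ≠ 0) :
    phiSeries q A y - rescale q (phiSeries q A y) = -(C A * (X * (rescale q (phiSeries q A y) +
      C y * rescale q (rescale q (phiSeries q A y))))) := by
  ext n
  rcases n with _ | n
  · simp only [map_sub, map_neg, coeff_rescale, coeff_C_mul, coeff_zero_X_mul, pow_zero, one_mul,
      sub_self, mul_zero, neg_zero]
  · have h := coeff_phiSeries_succ (A := A) (y := y) hq n
    simp only [map_sub, map_neg, map_add, coeff_rescale, coeff_C_mul, coeff_succ_X_mul]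
    linear_combination h

/-- The recursion is multiplied by `q` because `1 - A q^k`, in terms of the index `k + 1`, is `1 -
(A/q) q^{k+1}`. -/
theorem besselSeries_eq (hq : ∀ n, qPoch q q n ≠ 0) (hA : ∀ n, qPoch A q n ≠ 0) :
    C q * (besselSeries q A y - rescale q (besselSeries q A y)) -
      C A * (rescale q (besselSeries q A y) - rescale q (rescale q (besselSeries q A y))) =
      -(C (q * A * y) * (X * (rescale q (rescale q (besselSeries q A y))))) := by
  ext n
  rcases n with _ | n
  · simp only [map_sub, map_neg, coeff_rescale, coeff_C_mul, coeff_zero_X_mul, pow_zero, one_mul,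
      sub_self, mul_zero, neg_zero]
  · have h := coeff_besselSeries_succ (A := A) (y := y) hq hA n
    simp only [map_sub, map_neg, coeff_rescale, coeff_C_mul, coeff_succ_X_mul]
    linear_combination q * h

theorem coeff_euler_mul_phi_recurrence (hq : ∀ n, qPoch q q n ≠ 0) (n : ℕ) :
    (1 - q ^ (n + 2)) * coeff (n + 2) (eulerSeries q * phiSeries q A y) =
      (1 + q - q ^ (n + 2) - A * q ^ (n + 1) - y * A * q ^ (2 * n + 2)) *
        coeff (n + 1) (eulerSeries q * phiSeries q A y) -
      q * (1 - A * q ^ n) * coeff n (eulerSeries q * phiSeries q A y) := by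
  have h1 := one_sub_X_mul_eulerSeries hq
  have h2 := congrArg (rescale q) h1
  rw [map_mul, map_sub, map_one, rescale_X] at h2
  have h3 := phiSeries_eq (A := A) (y := y) hq
  have h4 := map_mul (rescale q) (eulerSeries q) (phiSeries q A y)
  have h5 : rescale q (rescale q (eulerSeries q * phiSeries q A y)) =
      rescale q (rescale q (eulerSeries q)) * rescale q (rescale q (phiSeries q A y)) := by
    rw [map_mul, map_mul]
  set M := eulerSeries q * phiSeries q A y with hM
  -- The equation of `phiSeries` is multiplied by `(1 - t)(1 - q t) E(t)`, where `E` is Euler's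
  -- series. Since `(1 - t) E(t) = E(q t)`, each product recombines into `M(t)`, `M(q t)` or `M(q²
  -- t)`.
  have key : M - (1 + C q) * (X * M) + C q * (X * (X * M)) - rescale q M + C q * (X * rescale q M)
      + C A * (X * rescale q M) - C A * (C q * (X * (X * rescale q M)))
      + C A * (C y * (X * rescale q (rescale q M))) = 0 := by
    rw [h5, h4, ← h2, ← h1, hM]
    linear_combination ((1 - X) * (1 - C q * X) * eulerSeries q) * h3
  have h := congrArg (coeff (n + 2)) key
  simp only [map_sub, map_add, coeff_rescale, coeff_C_mul, coeff_succ_X_mul, add_mul, one_mul,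
    map_zero] at h
  linear_combination h

theorem coeff_euler_mul_bessel_recurrence (hq : ∀ n, qPoch q q n ≠ 0)
    (hA : ∀ n, qPoch A q n ≠ 0) (hq0 : q ≠ 0) (n : ℕ) :
    (1 - q ^ (n + 2)) * (1 - A * q ^ (n + 1)) *
        coeff (n + 2) (eulerSeries q * besselSeries q A y) =
      (1 + q - q ^ (n + 2) - A * q ^ (n + 1) - y * A * q ^ (2 * n + 2)) *
        coeff (n + 1) (eulerSeries q * besselSeries q A y) -
      q * coeff n (eulerSeries q * besselSeries q A y) := by
  have h1 := one_sub_X_mul_eulerSeries hq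
  have h2 := congrArg (rescale q) h1
  rw [map_mul, map_sub, map_one, rescale_X] at h2
  have h3 := besselSeries_eq (A := A) (y := y) hq hA
  have h4 := map_mul (rescale q) (eulerSeries q) (besselSeries q A y)
  have h5 : rescale q (rescale q (eulerSeries q * besselSeries q A y)) =
      rescale q (rescale q (eulerSeries q)) * rescale q (rescale q (besselSeries q A y)) := by
    rw [map_mul, map_mul]
  set M := eulerSeries q * besselSeries q A y with hM
  have key : C q * (M - (1 + C q) * (X * M) + C q * (X * (X * M)) - rescale q M
      + C q * (X * rescale q M)) - C A * (rescale q M - C q * (X * rescale q M)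
      - rescale q (rescale q M)) + C (q * A * y) * (X * rescale q (rescale q M)) = 0 := by
    rw [h5, h4, ← h2, ← h1, hM]
    linear_combination ((1 - X) * (1 - C q * X) * eulerSeries q) * h3
  have h := congrArg (coeff (n + 2)) key
  simp only [map_sub, map_add, coeff_rescale, coeff_C_mul, coeff_succ_X_mul, add_mul, one_mul,
    map_zero] at h
  refine mul_left_cancel₀ hq0 ?_
  linear_combination h

/-- The two expansions of the `q`-Laguerre polynomials agree. -/
theorem coeff_euler_mul_phi (hq : ∀ n, qPoch q q n ≠ 0) (hA : ∀ n, qPoch A q n ≠ 0)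
    (hq0 : q ≠ 0) (n : ℕ) : coeff n (eulerSeries q * phiSeries q A y) =
      qPoch A q n * coeff n (eulerSeries q * besselSeries q A y) := by
  induction n using Nat.strong_induction_on with
  | _ n ih =>
    match n with
    | 0 => simp [coeff_mul, eulerSeries, phiSeries, besselSeries, qPoch_zero]
    | 1 =>
      have h := hq 1
      have g := hA 1
      rw [qPoch_succ, qPoch_zero, pow_zero, mul_one, one_mul] at h g
      simp [coeff_mul, Finset.Nat.antidiagonal_succ, eulerSeries, phiSeries,
        besselSeries, qPoch_zero, qPoch_succ]
      field_simp
      ring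
    | n + 2 =>
      have h := hq (n + 2)
      rw [qPoch_succ] at h
      have h2 : 1 - q * q ^ (n + 1) ≠ 0 := right_ne_zero_of_mul h
      refine mul_left_cancel₀ h2 ?_
      have e1 := coeff_euler_mul_phi_recurrence (A := A) (y := y) hq n
      have e2 := coeff_euler_mul_bessel_recurrence (A := A) (y := y) hq hA hq0 n
      rw [ih n (by omega), ih (n + 1) (by omega)] at e1
      rw [qPoch_succ A q (n + 1)]
      rw [qPoch_succ A q n] at e1 ⊢
      -- The factor `(A;q)_{n+1}` turns the recurrence of the `₀φ₁` product into that of the `₁φ₁`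
      -- product.
      linear_combination e1 - (qPoch A q n * (1 - A * q ^ n)) * e2

end FormalSeries

/-! ### The `q`-Laguerre polynomials and their recurrence. -/

section QLaguerre

variable {q : ℝ}

theorem qPoch_pos (hq0 : 0 < q) (hq1 : q < 1) {a : ℝ} (ha : a < 1) (n : ℕ) :
    0 < qPoch a q n := by
  refine Finset.prod_pos fun i _ => ?_
  have h1 : 0 < q ^ i := by positivity
  have h2 : q ^ i ≤ 1 := pow_le_one₀ hq0.le hq1.le
  rcases le_or_gt a 0 with h | h <;> nlinarith

theorem ofReal_qPoch (a q : ℝ) (n : ℕ) : ((qPoch a q n : ℝ) : ℂ) = qPoch (a : ℂ) q n := by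
  simp [qPoch]

theorem qPoch_ne_zero (hq0 : 0 < q) (hq1 : q < 1) {a : ℝ} (ha : a < 1) (n : ℕ) :
    qPoch (a : ℂ) q n ≠ 0 := by
  rw [← ofReal_qPoch]
  exact Complex.ofReal_ne_zero.2 (qPoch_pos hq0 hq1 ha n).ne'

/-- Reversing the factors of `(q^{-n};q)_k` gives `(q;q)_n / (q;q)_{n-k}` up to sign and a power of
`q`. This makes the defining sum of `L_n` a Cauchy product of Euler's series with `besselSeries`. -/
theorem qPoch_rpow_neg_mul (hq0 : 0 < q) (l : ℝ) (n k : ℕ) (hk : k ≤ n) :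
    qPoch (q ^ (-(n : ℝ))) q k * q ^ ((k : ℝ) * (n + (2 * l - 1) + ((k : ℝ) + 1) / 2)) *
      qPoch q q (n - k) = (-1) ^ k * q ^ (k * (k - 1)) * (q ^ (2 * l)) ^ k * qPoch q q n := by
  induction k with
  | zero => simp [qPoch_zero]
  | succ k ih =>
    have ih := ih (by omega)
    obtain ⟨m, rfl⟩ : ∃ m, n = m + (k + 1) := ⟨n - (k + 1), by omega⟩
    have e1 : m + (k + 1) - (k + 1) = m := by omega
    have e2 : m + (k + 1) - k = m + 1 := by omega
    have e3 : (k + 1) * (k + 1 - 1) = k * (k - 1) + k + k := by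
      cases k <;> simp; ring
    have e4 : q ^ (((k + 1 : ℕ) : ℝ) * ((m + (k + 1) : ℕ) + (2 * l - 1) +
        (((k + 1 : ℕ) : ℝ) + 1) / 2)) =
        q ^ ((k : ℝ) * ((m + (k + 1) : ℕ) + (2 * l - 1) + ((k : ℝ) + 1) / 2)) *
          (q ^ (2 * l) * q ^ (m + 1) * q ^ k * q ^ k) := by
      simp only [← Real.rpow_natCast, ← Real.rpow_add hq0]
      congr 1
      push_cast
      ring
    have e5 : q ^ (-((m + (k + 1) : ℕ) : ℝ)) * q ^ k * q ^ (m + 1) = 1 := by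
      simp only [← Real.rpow_natCast, ← Real.rpow_add hq0]
      rw [← Real.rpow_zero q]
      congr 1
      push_cast
      ring
    rw [e2, qPoch_succ q q m] at ih
    rw [e1, e3, e4, qPoch_succ]
    linear_combination (-(q ^ (2 * l)) * q ^ k * q ^ k) * ih -
      qPoch (q ^ (-((m + (k + 1) : ℕ) : ℝ))) q k *
        q ^ ((k : ℝ) * ((m + (k + 1) : ℕ) + (2 * l - 1) + ((k : ℝ) + 1) / 2)) *
        qPoch q q m * (q ^ (2 * l) * q ^ k * q ^ k) * e5

theorem rpow_two_mul_lt_one (hq0 : 0 < q) (hq1 : q < 1) {l : ℝ} (hl : 0 < l) :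
    q ^ (2 * l) < 1 := Real.rpow_lt_one hq0.le hq1 (by positivity)

theorem qLaguerre_eq_coeff (hq0 : 0 < q) (hq1 : q < 1) {l : ℝ} (hl : 0 < l) (n : ℕ) (y : ℂ) :
    qLaguerre q (2 * l - 1) n y = PowerSeries.coeff n
      (eulerSeries (q : ℂ) * phiSeries (q : ℂ) ((q ^ (2 * l) : ℝ) : ℂ) y) := by
  have hA := rpow_two_mul_lt_one hq0 hq1 hl
  rw [coeff_euler_mul_phi (qPoch_ne_zero hq0 hq1 hq1) (qPoch_ne_zero hq0 hq1 hA)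
    (Complex.ofReal_ne_zero.2 hq0.ne'), mul_comm (eulerSeries _), PowerSeries.coeff_mul,
    Finset.Nat.sum_antidiagonal_eq_sum_range_succ_mk, qLaguerre, sub_add_cancel,
    Finset.mul_sum, Finset.mul_sum]
  refine Finset.sum_congr rfl fun k hk => ?_
  have hk : k ≤ n := by simpa [Nat.lt_succ_iff] using hk
  have h := congrArg (fun x : ℝ => (x : ℂ)) (qPoch_rpow_neg_mul hq0 l n k hk)
  have h1 := qPoch_ne_zero hq0 hq1 hq1 n
  have h2 := qPoch_ne_zero hq0 hq1 hq1 k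
  have h3 := qPoch_ne_zero hq0 hq1 hq1 (n - k)
  have h4 := qPoch_ne_zero hq0 hq1 hA k
  simp only [besselSeries, eulerSeries, PowerSeries.coeff_mk]
  simp only [Complex.ofReal_mul, Complex.ofReal_div, Complex.ofReal_pow, Complex.ofReal_neg,
    Complex.ofReal_one, ofReal_qPoch] at h ⊢
  generalize ((q ^ ((k : ℝ) * (n + (2 * l - 1) + ((k : ℝ) + 1) / 2)) : ℝ) : ℂ) = r at h ⊢
  rw [neg_pow y]
  field_simp
  linear_combination (qPoch (((q ^ (2 * l) : ℝ) : ℂ)) (q : ℂ) n * y ^ k) * h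

theorem qLaguerre_zero (hq0 : 0 < q) (hq1 : q < 1) {l : ℝ} (hl : 0 < l) (y : ℂ) :
    qLaguerre q (2 * l - 1) 0 y = 1 := by
  rw [qLaguerre_eq_coeff hq0 hq1 hl]
  simp [PowerSeries.coeff_mul, eulerSeries, phiSeries, qPoch_zero]

theorem qLaguerre_one (hq0 : 0 < q) (hq1 : q < 1) {l : ℝ} (hl : 0 < l) (y : ℂ) :
    (1 - q) * qLaguerre q (2 * l - 1) 1 y =
      1 - (q ^ (2 * l) : ℝ) - y * (q ^ (2 * l) : ℝ) := by
  have h : (1 - q : ℂ) ≠ 0 := by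
    simpa [qPoch_succ, qPoch_zero] using qPoch_ne_zero hq0 hq1 hq1 1
  rw [qLaguerre_eq_coeff hq0 hq1 hl]
  simp [PowerSeries.coeff_mul, Finset.Nat.antidiagonal_succ, eulerSeries, phiSeries, qPoch_zero,
    qPoch_succ]
  field_simp
  ring

/-- The three-term recurrence of the `q`-Laguerre polynomials. -/
theorem qLaguerre_recurrence (hq0 : 0 < q) (hq1 : q < 1) {l : ℝ} (hl : 0 < l) (n : ℕ) (y : ℂ) :
    (1 - (q : ℂ) ^ (n + 2)) * qLaguerre q (2 * l - 1) (n + 2) y =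
      (1 + q - (q : ℂ) ^ (n + 2) - (q ^ (2 * l) : ℝ) * (q : ℂ) ^ (n + 1) -
        y * (q ^ (2 * l) : ℝ) * (q : ℂ) ^ (2 * n + 2)) * qLaguerre q (2 * l - 1) (n + 1) y -
      q * (1 - (q ^ (2 * l) : ℝ) * (q : ℂ) ^ n) * qLaguerre q (2 * l - 1) n y := by
  simp only [qLaguerre_eq_coeff hq0 hq1 hl]
  exact coeff_euler_mul_phi_recurrence (qPoch_ne_zero hq0 hq1 hq1) n

theorem qLaguerre_conj (q α : ℝ) (n : ℕ) (y : ℂ) :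
    qLaguerre q α n (starRingEnd ℂ y) = starRingEnd ℂ (qLaguerre q α n y) := by
  simp only [qLaguerre, map_mul, map_sum, map_pow, Complex.conj_ofReal]

end QLaguerre

/-! ### Formal eigenseries of `I₃`. -/

section Eigenfunctions

variable {q l : ℝ}

theorem sqrt_qNum (hq0 : 0 < q) (hq1 : q < 1) {a : ℝ} (ha : 0 < a) :
    √(qNum q a) = q ^ ((1 - a) / 4) * √(1 - q ^ a) / √(1 - q) := by
  have h1 : q ^ ((1 - a) / 2) = (q ^ ((1 - a) / 4)) ^ 2 := by
    rw [← Real.rpow_natCast, ← Real.rpow_mul hq0.le]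
    congr 1
    push_cast
    ring
  have h2 := Real.rpow_lt_one hq0.le hq1 ha
  rw [qNum_eq hq0 hq1, Real.sqrt_div' _ (by linarith), Real.sqrt_mul (by positivity), h1,
    Real.sqrt_sq (by positivity)]

/-- The square roots in `c_n` cancel those in `P_n`, leaving per step `q^{1/2}` from the weight and
`q^{(1-2l)/4}` from the `q`-numbers. The reciprocal of this base is the radius `q^{(2l-3)/4}`. -/
theorem overlap_mul_normConst_real (hq0 : 0 < q) (hq1 : q < 1) (hl : 0 < l) (n : ℕ) :
    q ^ ((n : ℝ) / 2) * (√(qPoch q q n) / √(qPoch (q ^ (2 * l)) q n)) * normConst q l n =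
      (q ^ ((3 - 2 * l) / 4)) ^ n := by
  have hA := rpow_two_mul_lt_one hq0 hq1 hl
  induction n with
  | zero => simp [qPoch_zero, normConst]
  | succ n ih =>
    have p1 := qPoch_pos hq0 hq1 hq1 n
    have p2 := qPoch_pos hq0 hq1 hA n
    have e1 : q ^ (2 * l + n) = q ^ (2 * l) * q ^ n := by
      rw [Real.rpow_add hq0, Real.rpow_natCast]
    have e2 : q ^ ((n : ℝ) + 1) = q * q ^ n := by
      rw [Real.rpow_add hq0, Real.rpow_natCast, Real.rpow_one, mul_comm]
    have hqn : q ^ n ≤ 1 := pow_le_one₀ hq0.le hq1.le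
    have hqn' : 0 < q ^ n := by positivity
    have s1 : 0 < √(1 - q * q ^ n) := Real.sqrt_pos.2 (by nlinarith)
    have s2 : 0 < √(1 - q ^ (2 * l) * q ^ n) := Real.sqrt_pos.2 (by nlinarith)
    have s3 : 0 < √(1 - q) := Real.sqrt_pos.2 (by linarith)
    have e3 : q ^ ((3 - 2 * l) / 4) * q ^ ((1 - (n + 1 : ℝ)) / 4) =
        q ^ (1 / 2 : ℝ) * q ^ ((1 - (2 * l + n)) / 4) := by
      rw [← Real.rpow_add hq0, ← Real.rpow_add hq0]
      ring_nf
    have e4 : q ^ (((n + 1 : ℕ) : ℝ) / 2) = q ^ ((n : ℝ) / 2) * q ^ (1 / 2 : ℝ) := by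
      rw [← Real.rpow_add hq0]
      push_cast
      ring_nf
    have p3 : 0 < q ^ ((1 - (n + 1 : ℝ)) / 4) := Real.rpow_pos_of_pos hq0 _
    have p4 := Real.sqrt_pos.2 p1
    have p5 := Real.sqrt_pos.2 p2
    rw [pow_succ, ← ih, normConst_succ, qPoch_succ, qPoch_succ, Real.sqrt_mul p1.le,
      Real.sqrt_mul p2.le, sqrt_qNum hq0 hq1 (by positivity), sqrt_qNum hq0 hq1 (by positivity),
      e1, e2, e4]
    generalize q ^ ((1 - (n + 1 : ℝ)) / 4) = u at *
    generalize q ^ ((1 - (2 * l + n)) / 4) = v at *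
    generalize q ^ ((3 - 2 * l) / 4) = w at *
    generalize q ^ (1 / 2 : ℝ) = z at *
    generalize √(1 - q * q ^ n) = c at *
    generalize √(1 - q ^ (2 * l) * q ^ n) = d at *
    field_simp
    linear_combination (-normConst q l n) * e3

theorem coeff_eigenSeries (hq0 : 0 < q) (hq1 : q < 1) (hl : 0 < l) (lam : ℂ) (n : ℕ) :
    PowerSeries.coeff n (eigenSeries q l lam) =
      ((q ^ ((3 - 2 * l) / 4) : ℝ) : ℂ) ^ n *
        qLaguerre q (2 * l - 1) n (2 * (1 - q) * lam) := by
  rw [eigenSeries, PowerSeries.coeff_mk, overlap, ← Complex.ofReal_pow,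
    ← overlap_mul_normConst_real hq0 hq1 hl, Complex.ofReal_mul _ (normConst q l n)]
  ring

/-- Together with `raising_coeff` and `diag_eq`: multiplying row `n` of the eigenvalue equation by
`2(1-q) q^{2l+2n}` clears the negative powers of `q` and produces the coefficients of the
`q`-Laguerre recurrence, with `2(1-q)λ` as variable. -/
theorem lowering_coeff (hq0 : 0 < q) (hq1 : q < 1) (n : ℕ) :
    q ^ (2 * l) * q ^ (2 * n) * (1 - q) * (q ^ (-(3 / 4) * (l + n)) * qNum q (n + 1) *
      q ^ (-(3 / 4) * (l + (n + 1)))) * q ^ ((3 - 2 * l) / 4) = 1 - q ^ (n + 1) := by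
  have h1 : (1 - q) ≠ 0 := by linarith
  have e2 : q ^ ((n : ℝ) + 1) = q ^ (n + 1) := by
    rw [← Real.rpow_natCast]; push_cast; rfl
  have e3 : q ^ (2 * l) * q ^ (2 * n) * q ^ (-(3 / 4) * (l + n)) *
      q ^ ((1 - ((n : ℝ) + 1)) / 2) * q ^ (-(3 / 4) * (l + (n + 1))) *
      q ^ ((3 - 2 * l) / 4) = 1 := by
    rw [← Real.rpow_natCast]
    simp only [← Real.rpow_add hq0]
    refine Eq.trans ?_ (Real.rpow_zero q)
    congr 1
    push_cast
    ring
  rw [qNum_eq hq0 hq1, e2]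
  field_simp
  field_simp at e3
  linear_combination (1 - q ^ (n + 1)) * e3

theorem raising_coeff (hq0 : 0 < q) (hq1 : q < 1) (n : ℕ) :
    q ^ (2 * l) * q ^ (2 * (n + 1)) * (1 - q) * (q ^ (-(3 / 4) * (l + (n + 1))) *
      qNum q (2 * l + n) * q ^ (-(3 / 4) * (l + n))) =
      q ^ ((3 - 2 * l) / 4) * q * (1 - q ^ (2 * l) * q ^ n) := by
  have h1 : (1 - q) ≠ 0 := by linarith
  have e1 : q ^ (2 * l + n) = q ^ (2 * l) * q ^ n := by
    rw [Real.rpow_add hq0, Real.rpow_natCast]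
  have e3 : q ^ (2 * l) * q ^ (2 * (n + 1)) * q ^ (-(3 / 4) * (l + (n + 1))) *
      q ^ ((1 - (2 * l + (n : ℝ))) / 2) * q ^ (-(3 / 4) * (l + n)) =
      q ^ ((3 - 2 * l) / 4) * q := by
    rw [← Real.rpow_natCast, ← Real.rpow_add_one hq0.ne']
    simp only [← Real.rpow_add hq0]
    congr 1
    push_cast
    ring
  rw [qNum_eq hq0 hq1, e1, ← e3]
  field_simp

theorem diag_eq (hq0 : 0 < q) (hq1 : q < 1) (n : ℕ) :
    q ^ (2 * l) * q ^ (2 * n) * (2 * (1 - q)) * diag q l n =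
      1 + q - q ^ (n + 1) - q ^ (2 * l) * q ^ n := by
  have h1 : (1 - q) ≠ 0 := by linarith
  have e1 : q ^ (2 * l) * q ^ (2 * n) * q ^ (-2 * (l + n)) = 1 := by
    rw [← Real.rpow_natCast]
    simp only [← Real.rpow_add hq0]
    refine Eq.trans ?_ (Real.rpow_zero q)
    congr 1
    push_cast
    ring
  have e2 : q ^ (2 * l) * q ^ (2 * n) * (q ^ l * q ^ (-1 * (l + n))) = q ^ (2 * l) * q ^ n := by
    simp only [← Real.rpow_natCast, ← Real.rpow_add hq0]
    congr 1
    push_cast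
    ring
  have e3 : q ^ (2 * l) * q ^ (2 * n) * (q ^ (1 - l) * q ^ (-1 * (l + n))) = q ^ (n + 1) := by
    simp only [← Real.rpow_natCast, ← Real.rpow_add hq0]
    congr 1
    push_cast
    ring
  rw [diag]
  generalize q ^ (-2 * (l + n)) = u at *
  generalize q ^ (-1 * (l + n)) = v at *
  field_simp
  linear_combination (1 + q) * e1 - e2 - e3

theorem I3Formal_eigenSeries (hq0 : 0 < q) (hq1 : q < 1) (hl : 0 < l) (lam : ℂ) :
    I3Formal q l (eigenSeries q l lam) = lam • eigenSeries q l lam := by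
  have hq : (q : ℂ) ≠ 0 := Complex.ofReal_ne_zero.2 hq0.ne'
  have hA : ((q ^ (2 * l) : ℝ) : ℂ) ≠ 0 :=
    Complex.ofReal_ne_zero.2 (Real.rpow_pos_of_pos hq0 _).ne'
  have hq1' : (1 - q : ℂ) ≠ 0 := by
    rw [← Complex.ofReal_one, ← Complex.ofReal_sub]
    exact Complex.ofReal_ne_zero.2 (by linarith)
  ext n
  rw [PowerSeries.coeff_smul]
  refine mul_left_cancel₀ (a := ((q ^ (2 * l) : ℝ) : ℂ) * (q : ℂ) ^ (2 * n) * (2 * (1 - q)))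
    (by simp [hA, hq, hq1']) ?_
  rcases n with _ | n
  · have h1 := congrArg (fun x : ℝ => (x : ℂ)) (lowering_coeff (l := l) hq0 hq1 0)
    have h2 := congrArg (fun x : ℝ => (x : ℂ)) (diag_eq (l := l) hq0 hq1 0)
    have h3 := qLaguerre_one hq0 hq1 hl (2 * (1 - q) * lam)
    rw [coeff_zero_I3Formal, coeff_eigenSeries hq0 hq1 hl, coeff_eigenSeries hq0 hq1 hl,
      qLaguerre_zero hq0 hq1 hl]
    simp only [Nat.cast_zero, add_zero, zero_add] at h1 h2
    push_cast at h1 h2 h3 ⊢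
    linear_combination (-qLaguerre q (2 * l - 1) 1 (2 * (1 - q) * lam)) * h1 + h2 - h3
  · have h1 := congrArg (fun x : ℝ => (x : ℂ)) (lowering_coeff (l := l) hq0 hq1 (n + 1))
    have h2 := congrArg (fun x : ℝ => (x : ℂ)) (diag_eq (l := l) hq0 hq1 (n + 1))
    have h3 := congrArg (fun x : ℝ => (x : ℂ)) (raising_coeff (l := l) hq0 hq1 n)
    have h4 := qLaguerre_recurrence hq0 hq1 hl n (2 * (1 - q) * lam)
    rw [coeff_succ_I3Formal, coeff_eigenSeries hq0 hq1 hl, coeff_eigenSeries hq0 hq1 hl,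
      coeff_eigenSeries hq0 hq1 hl]
    push_cast at h1 h2 h3 h4 ⊢
    generalize qLaguerre q (2 * l - 1) n (2 * (1 - q) * lam) = a at *
    generalize qLaguerre q (2 * l - 1) (n + 1) (2 * (1 - q) * lam) = b at *
    generalize qLaguerre q (2 * l - 1) (n + 2) (2 * (1 - q) * lam) = c at *
    generalize ((q ^ ((3 - 2 * l) / 4) : ℝ) : ℂ) = s at *
    linear_combination (-a * s ^ n) * h3 + (b * s ^ (n + 1)) * h2 - (c * s ^ (n + 1)) * h1 -
      s ^ (n + 1) * h4

theorem coeff_zero_eigenSeries (hq0 : 0 < q) (hq1 : q < 1) (hl : 0 < l) (lam : ℂ) :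
    PowerSeries.coeff 0 (eigenSeries q l lam) = 1 := by
  rw [coeff_eigenSeries hq0 hq1 hl, qLaguerre_zero hq0 hq1 hl, pow_zero, one_mul]

/-- The lowering entries never vanish, so row `n` of the equation determines coefficient `n + 1`
from the earlier ones. -/
theorem eq_zero_of_I3Formal_eq_smul (hq0 : 0 < q) (hq1 : q < 1) {lam : ℂ} {f : ℂ⟦X⟧}
    (hf : I3Formal q l f = lam • f) (h0 : PowerSeries.coeff 0 f = 0) : f = 0 := by
  have hne (n : ℕ) : ((q ^ (-(3 / 4) * (l + n)) * qNum q (n + 1) *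
      q ^ (-(3 / 4) * (l + (n + 1))) : ℝ) : ℂ) ≠ 0 :=
    Complex.ofReal_ne_zero.2 (mul_pos (mul_pos (Real.rpow_pos_of_pos hq0 _)
      (qNum_pos hq0 hq1 (by positivity))) (Real.rpow_pos_of_pos hq0 _)).ne'
  ext n
  rw [map_zero]
  induction n using Nat.strong_induction_on with
  | _ n ih =>
    match n with
    | 0 => exact h0
    | 1 =>
      have h := congrArg (PowerSeries.coeff 0) hf
      have h1 := hne 0
      simp only [Nat.cast_zero, add_zero, zero_add] at h1
      rw [coeff_zero_I3Formal, PowerSeries.coeff_smul, h0] at h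
      simp only [mul_zero, smul_zero, add_zero] at h
      exact (mul_eq_zero.1 h).resolve_left (mul_ne_zero (by norm_num) h1)
    | n + 2 =>
      have h := congrArg (PowerSeries.coeff (n + 1)) hf
      have h1 := hne (n + 1)
      rw [coeff_succ_I3Formal, PowerSeries.coeff_smul, ih n (by omega), ih (n + 1) (by omega)] at h
      simp only [mul_zero, smul_zero, zero_add] at h
      simp only [Nat.cast_add, Nat.cast_one] at h1
      exact (mul_eq_zero.1 h).resolve_left (mul_ne_zero (by norm_num) h1)

/-- The formal eigenfunctions of `I₃` are the multiples of the eigenseries. -/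
theorem I3Formal_eq_smul_iff (hq0 : 0 < q) (hq1 : q < 1) (hl : 0 < l) (lam : ℂ) (ζ : ℂ⟦X⟧) :
    I3Formal q l ζ = lam • ζ ↔ ∃ a : ℂ, ζ = a • eigenSeries q l lam := by
  constructor
  · intro h
    refine ⟨PowerSeries.coeff 0 ζ, sub_eq_zero.1 (eq_zero_of_I3Formal_eq_smul hq0 hq1
      (l := l) (lam := lam) ?_ ?_)⟩
    · rw [map_sub, map_smul, h, I3Formal_eigenSeries hq0 hq1 hl, smul_sub, smul_comm]
    · rw [map_sub, PowerSeries.coeff_smul, coeff_zero_eigenSeries hq0 hq1 hl, smul_eq_mul,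
        mul_one, sub_self]
  · rintro ⟨a, rfl⟩
    rw [map_smul, I3Formal_eigenSeries hq0 hq1 hl, smul_comm]

end Eigenfunctions

/-! ### Convergence, the generating function and square-summability. -/

section Summability

open Filter Topology

/-- The ratio is given multiplicatively because the series for `₁φ₁` terminates, with zero terms,
when some factor of `(-y;q)_k` vanishes. -/
theorem summable_norm_of_ratio_tendsto {f g : ℕ → ℂ} {c : ℂ} (h : ∀ n, f (n + 1) = g n * f n)
    (hg : Tendsto g atTop (𝓝 c)) (hc : ‖c‖ < 1) : Summable fun n => ‖f n‖ := by
  obtain ⟨r, hcr, hr⟩ := exists_between hc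
  refine summable_of_ratio_norm_eventually_le hr ?_
  filter_upwards [hg.norm.eventually_lt_const hcr] with n hn
  rw [norm_norm, norm_norm, h, norm_mul]
  gcongr

variable {q : ℝ}

theorem tendsto_ofReal_pow (hq0 : 0 < q) (hq1 : q < 1) :
    Tendsto (fun n : ℕ => (q : ℂ) ^ n) atTop (𝓝 0) :=
  tendsto_pow_atTop_nhds_zero_of_norm_lt_one (by
    rwa [Complex.norm_real, Real.norm_of_nonneg hq0.le])

theorem summable_norm_eulerSeries (hq0 : 0 < q) (hq1 : q < 1) {t : ℂ} (ht : ‖t‖ < 1) :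
    Summable fun n => ‖PowerSeries.coeff n (eulerSeries (q : ℂ)) * t ^ n‖ := by
  refine summable_norm_of_ratio_tendsto (g := fun n => t / (1 - q * (q : ℂ) ^ n)) (c := t)
    (fun n => ?_) ?_ ht
  · simp only [eulerSeries, PowerSeries.coeff_mk, qPoch_succ, mul_inv, pow_succ t]
    ring
  · have h := ((tendsto_ofReal_pow hq0 hq1).const_mul (q : ℂ)).const_sub 1
    rw [mul_zero, sub_zero] at h
    have h2 := (tendsto_const_nhds (x := t)).div h one_ne_zero
    rw [div_one] at h2
    exact h2

theorem summable_norm_phiSeries (hq0 : 0 < q) (hq1 : q < 1) (A y t : ℂ) :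
    Summable fun n => ‖PowerSeries.coeff n (phiSeries (q : ℂ) A y) * t ^ n‖ := by
  refine summable_norm_of_ratio_tendsto (c := 0)
    (g := fun n => -A * ((q : ℂ) ^ n + y * ((q : ℂ) ^ n) ^ 2) * t / (1 - q * (q : ℂ) ^ n))
    (fun n => ?_) ?_ (by simp)
  · have h := coeff_phiSeries_succ (A := A) (y := y) (qPoch_ne_zero hq0 hq1 hq1) n
    have h1 := qPoch_ne_zero hq0 hq1 hq1 (n + 1)
    rw [qPoch_succ] at h1
    have h2 := right_ne_zero_of_mul h1
    rw [pow_succ'] at h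
    rw [div_mul_eq_mul_div, eq_div_iff h2, pow_succ]
    linear_combination (t ^ n * t) * h
  · have h0 := tendsto_ofReal_pow hq0 hq1
    have h := (h0.const_mul (q : ℂ)).const_sub 1
    rw [mul_zero, sub_zero] at h
    have h2 := ((h0.add ((h0.pow 2).const_mul y)).const_mul (-A)).mul_const t
    have h3 := h2.div h one_ne_zero
    have e : -A * (0 + y * 0 ^ 2) * t / 1 = 0 := by simp
    rw [e] at h3
    exact h3

/-- Euler's identity `∑ tⁿ / (q;q)_n = 1 / (t;q)_∞`. -/
theorem tsum_eulerSeries (hq0 : 0 < q) (hq1 : q < 1) {t : ℂ} (ht : ‖t‖ < 1) :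
    ∑' n, PowerSeries.coeff n (eulerSeries (q : ℂ)) * t ^ n = 1 / qPochInf t q := by
  let F : ℂ → ℂ := fun s => ∑' n, PowerSeries.coeff n (eulerSeries (q : ℂ)) * s ^ n
  have hqn : ‖(q : ℂ)‖ = q := by rw [Complex.norm_real, Real.norm_of_nonneg hq0.le]
  have hstep (s : ℂ) (hs : ‖s‖ < 1) : (1 - s) * F s = F (s * q) := by
    have hs1 := (summable_norm_eulerSeries hq0 hq1 hs).of_norm
    have h2 : (∑' n, PowerSeries.coeff (n + 1) (eulerSeries (q : ℂ)) * s ^ (n + 1)) - s * F s =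
        ∑' n, PowerSeries.coeff (n + 1) (eulerSeries (q : ℂ)) * (s * q) ^ (n + 1) := by
      rw [← tsum_mul_left, ← ((summable_nat_add_iff 1).2 hs1).tsum_sub (hs1.mul_left s)]
      refine tsum_congr fun n => ?_
      have h := congrArg (PowerSeries.coeff (n + 1))
        (one_sub_X_mul_eulerSeries (qPoch_ne_zero hq0 hq1 hq1))
      rw [sub_mul, one_mul, map_sub, PowerSeries.coeff_succ_X_mul, PowerSeries.coeff_rescale] at h
      rw [mul_pow]
      linear_combination s ^ (n + 1) * h
    have hs2 : Summable fun n => PowerSeries.coeff n (eulerSeries (q : ℂ)) * (s * q) ^ n := by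
      refine (summable_norm_eulerSeries hq0 hq1 ?_).of_norm
      rw [norm_mul, hqn]
      nlinarith [norm_nonneg s]
    have h3 := hs1.tsum_eq_zero_add
    have h4 := hs2.tsum_eq_zero_add
    rw [pow_zero] at h3 h4
    rw [sub_mul, one_mul]
    change F s = _ at h3
    change F (s * q) = _ at h4
    rw [h4, ← h2]
    linear_combination h3
  -- Iterate the functional equation; by dominated convergence the right side then tends to the
  -- constant term `1`, so `F(t) (t;q)_∞ = 1`.
  have hprod (N : ℕ) : F t * ∏ i ∈ Finset.range N, (1 - t * (q : ℂ) ^ i) = F (t * (q : ℂ) ^ N) := by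
    induction N with
    | zero => simp
    | succ N ih =>
      rw [Finset.prod_range_succ, ← mul_assoc, ih, mul_comm, hstep, pow_succ, mul_assoc]
      rw [norm_mul, norm_pow, hqn]
      have : q ^ N ≤ 1 := pow_le_one₀ hq0.le hq1.le
      nlinarith [norm_nonneg t, pow_pos hq0 N]
  have hlim : Tendsto (fun N : ℕ => F (t * (q : ℂ) ^ N)) atTop (𝓝 1) := by
    have h1 : ∑' n, (if n = 0 then (1 : ℂ) else 0) = 1 := tsum_ite_eq 0 _
    rw [← h1]
    refine tendsto_tsum_of_dominated_convergence (summable_norm_eulerSeries hq0 hq1 ht)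
      (fun n => ?_) (Eventually.of_forall fun N n => ?_)
    · rcases n with _ | n
      · simp [eulerSeries, qPoch_zero]
      · rw [if_neg n.succ_ne_zero]
        have h2 := (((tendsto_ofReal_pow hq0 hq1).const_mul t).pow (n + 1)).const_mul
          (PowerSeries.coeff (n + 1) (eulerSeries (q : ℂ)))
        simpa using h2
    · rw [norm_mul, norm_mul, mul_pow, norm_mul]
      have h2 : ‖((q : ℂ) ^ N) ^ n‖ ≤ 1 := by
        rw [norm_pow, norm_pow, hqn]
        exact pow_le_one₀ (by positivity) (pow_le_one₀ hq0.le hq1.le)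
      exact mul_le_mul_of_nonneg_left (mul_le_of_le_one_right (norm_nonneg _) h2) (norm_nonneg _)
  have hmul : Multipliable fun i : ℕ => 1 - t * (q : ℂ) ^ i := by
    have hs : Summable fun i : ℕ => ‖-(t * (q : ℂ) ^ i)‖ := by
      simp only [norm_neg, norm_mul, norm_pow, hqn]
      exact (summable_geometric_of_lt_one hq0.le hq1).mul_left _
    simpa [sub_eq_add_neg] using multipliable_one_add_of_summable hs
  have hlim2 := hmul.hasProd.tendsto_prod_nat.const_mul (F t)
  simp only [hprod] at hlim2
  have h : F t * qPochInf t q = 1 := tendsto_nhds_unique hlim2 hlim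
  exact eq_one_div_of_mul_eq_one_left h

variable {l : ℝ}

theorem summable_norm_qLaguerre (hq0 : 0 < q) (hq1 : q < 1) (hl : 0 < l) (y : ℂ) {t : ℂ}
    (ht : ‖t‖ < 1) : Summable fun n => ‖qLaguerre q (2 * l - 1) n y * t ^ n‖ := by
  have h := summable_norm_sum_mul_antidiagonal_of_summable_norm
    (summable_norm_eulerSeries hq0 hq1 ht)
    (summable_norm_phiSeries hq0 hq1 ((q ^ (2 * l) : ℝ) : ℂ) y t)
  refine h.congr fun n => ?_
  rw [qLaguerre_eq_coeff hq0 hq1 hl, PowerSeries.coeff_mul, Finset.sum_mul]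
  congr 1
  refine Finset.sum_congr rfl fun p hp => ?_
  rw [← Finset.HasAntidiagonal.mem_antidiagonal.1 hp, pow_add]
  ring

/-- The generating function of the `q`-Laguerre polynomials. -/
theorem hasSum_qLaguerre (hq0 : 0 < q) (hq1 : q < 1) (hl : 0 < l) (y : ℂ) {t : ℂ}
    (ht : ‖t‖ < 1) : HasSum (fun n => qLaguerre q (2 * l - 1) n y * t ^ n)
      (1 / qPochInf t q * phi11 (-y) 0 q (((q ^ (2 * l) : ℝ) : ℂ) * t)) := by
  have h := tsum_mul_tsum_eq_tsum_sum_antidiagonal_of_summable_norm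
    (summable_norm_eulerSeries hq0 hq1 ht)
    (summable_norm_phiSeries hq0 hq1 ((q ^ (2 * l) : ℝ) : ℂ) y t)
  have h2 : phi11 (-y) 0 q (((q ^ (2 * l) : ℝ) : ℂ) * t) =
      ∑' n, PowerSeries.coeff n (phiSeries (q : ℂ) ((q ^ (2 * l) : ℝ) : ℂ) y) * t ^ n := by
    refine tsum_congr fun n => ?_
    have h3 : qPoch (0 : ℂ) q n = 1 := by simp [qPoch]
    rw [phiSeries, PowerSeries.coeff_mk, h3, one_mul, mul_pow]
    ring
  rw [h2, ← tsum_eulerSeries hq0 hq1 ht, h]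
  rw [(summable_norm_qLaguerre hq0 hq1 hl y ht).of_norm.hasSum_iff]
  refine tsum_congr fun n => ?_
  rw [qLaguerre_eq_coeff hq0 hq1 hl, PowerSeries.coeff_mul, Finset.sum_mul]
  refine Finset.sum_congr rfl fun p hp => ?_
  rw [← Finset.HasAntidiagonal.mem_antidiagonal.1 hp, pow_add]
  ring

theorem hasSum_eigenSeries (hq0 : 0 < q) (hq1 : q < 1) (hl : 0 < l) (lam x : ℂ)
    (hx : ‖x‖ < q ^ ((2 * l - 3) / 4)) :
    HasSum (fun n : ℕ => PowerSeries.coeff n (eigenSeries q l lam) * x ^ n)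
      (1 / qPochInf ((q ^ ((3 - 2 * l) / 4) : ℝ) * x) q * phi11 (-(2 * (1 - q) * lam)) 0 q
        ((q ^ (3 * (1 + 2 * l) / 4) : ℝ) * x)) := by
  have ht : ‖((q ^ ((3 - 2 * l) / 4) : ℝ) : ℂ) * x‖ < 1 := by
    have hp : 0 < q ^ ((3 - 2 * l) / 4) := Real.rpow_pos_of_pos hq0 _
    rw [norm_mul, Complex.norm_real, Real.norm_of_nonneg hp.le]
    calc _ < q ^ ((3 - 2 * l) / 4) * q ^ ((2 * l - 3) / 4) := by gcongr
      _ = 1 := by rw [← Real.rpow_add hq0, ← Real.rpow_zero q]; ring_nf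
  have h := hasSum_qLaguerre hq0 hq1 hl (2 * (1 - q) * lam) ht
  have e : q ^ (3 * (1 + 2 * l) / 4) = q ^ (2 * l) * q ^ ((3 - 2 * l) / 4) := by
    rw [← Real.rpow_add hq0]; ring_nf
  rw [e, Complex.ofReal_mul, mul_assoc ((q ^ (2 * l) : ℝ) : ℂ)]
  convert h using 2 with n
  rw [coeff_eigenSeries hq0 hq1 hl, mul_pow]
  ring

theorem summable_norm_overlap (hq0 : 0 < q) (hq1 : q < 1) (hl : 0 < l) (lam : ℂ) :
    Summable fun n => ‖overlap q l n lam‖ := by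
  have hA := rpow_two_mul_lt_one hq0 hq1 hl
  -- The weight `q^{n/2}` is split as `r^n * r^n`: one factor makes the square-root quotient
  -- summable, hence bounded by its total sum, and the other puts the generating series at `t = r`,
  -- inside the unit disc.
  set r : ℝ := q ^ (1 / 4 : ℝ)
  have hr0 : 0 < r := Real.rpow_pos_of_pos hq0 _
  have hr1 : r < 1 := Real.rpow_lt_one hq0.le hq1 (by norm_num)
  have hr : ‖(r : ℂ)‖ < 1 := by rwa [Complex.norm_real, Real.norm_of_nonneg hr0.le]
  have h1 : Summable fun n : ℕ =>
      ‖((√(qPoch q q n) / √(qPoch (q ^ (2 * l)) q n) * r ^ n : ℝ) : ℂ)‖ := by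
    refine summable_norm_of_ratio_tendsto (c := (r : ℂ)) (g := fun n =>
      ((√(1 - q * q ^ n) / √(1 - q ^ (2 * l) * q ^ n) * r : ℝ) : ℂ)) (fun n => ?_) ?_ hr
    · rw [← Complex.ofReal_mul, qPoch_succ, qPoch_succ,
        Real.sqrt_mul (qPoch_pos hq0 hq1 hq1 n).le, Real.sqrt_mul (qPoch_pos hq0 hq1 hA n).le]
      congr 1
      ring
    · refine (Complex.continuous_ofReal.tendsto r).comp ?_
      have h0 := tendsto_pow_atTop_nhds_zero_of_lt_one hq0.le hq1
      have h2 (a : ℝ) : Tendsto (fun n : ℕ => √(1 - a * q ^ n)) atTop (𝓝 1) := by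
        have := ((h0.const_mul a).const_sub 1).sqrt
        simpa using this
      simpa using ((h2 q).div (h2 (q ^ (2 * l))) one_ne_zero).mul_const r
  have h2 := summable_norm_qLaguerre hq0 hq1 hl (2 * (1 - q) * lam) hr
  refine Summable.of_nonneg_of_le (fun _ => norm_nonneg _) (fun n => ?_) (h2.mul_left
    (∑' n : ℕ, ‖((√(qPoch q q n) / √(qPoch (q ^ (2 * l)) q n) * r ^ n : ℝ) : ℂ)‖))
  have h3 : q ^ ((n : ℝ) / 2) = r ^ n * r ^ n := by
    simp only [r]
    rw [← Real.rpow_natCast, ← Real.rpow_mul hq0.le, ← Real.rpow_add hq0]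
    ring_nf
  have h4 : overlap q l n lam =
      ((√(qPoch q q n) / √(qPoch (q ^ (2 * l)) q n) * r ^ n : ℝ) : ℂ) *
        (qLaguerre q (2 * l - 1) n (2 * (1 - q) * lam) * (r : ℂ) ^ n) := by
    rw [overlap, h3]
    push_cast
    ring
  rw [h4, norm_mul]
  exact mul_le_mul_of_nonneg_right (h1.le_tsum n fun _ _ => norm_nonneg _) (norm_nonneg _)

end Summability

/-! ### The operator, its closure and its adjoint. -/

section Operator

variable {q l : ℝ}

theorem basisVec_apply (n m : ℕ) : (basisVec n : Hl) m = if m = n then 1 else 0 := by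
  simp only [basisVec, lp.single_apply, Pi.single_apply]

theorem inner_basisVec (n : ℕ) (v : Hl) : inner ℂ (basisVec n) v = v n := by
  rw [basisVec, lp.inner_single_left]; simp

theorem inner_basisVec_right (n : ℕ) (v : Hl) :
    inner ℂ v (basisVec n) = starRingEnd ℂ (v n) := by
  rw [← inner_conj_symm, inner_basisVec]

theorem mem_polySubspace_iff (hq0 : 0 < q) (hq1 : q < 1) (hl : 0 < l) (b : Hl) :
    b ∈ polySubspace q l ↔ ∃ N : ℕ, ∀ n, N ≤ n → b n = 0 := by
  constructor
  · rintro ⟨p, hp⟩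
    refine ⟨p.natDegree + 1, fun n hn => ?_⟩
    have h := congrArg (PowerSeries.coeff n) hp
    rw [coeff_toSeries] at h
    have h2 : p.coeff n = 0 := Polynomial.coeff_eq_zero_of_natDegree_lt (by omega)
    have h3 : b n * (normConst q l n : ℂ) = 0 := by rw [← h]; simpa using h2
    exact (mul_eq_zero.1 h3).resolve_right (normConst_ne_zero hq0 hq1 hl n)
  · rintro ⟨N, hN⟩
    refine ⟨PowerSeries.trunc N (toSeries q l b), ?_⟩
    ext n
    have : PowerSeries.coeff n ((PowerSeries.trunc N (toSeries q l b) : Polynomial ℂ) : ℂ⟦X⟧) =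
        PowerSeries.coeff n (toSeries q l b) := by
      rw [Polynomial.coeff_coe, PowerSeries.coeff_trunc]
      split_ifs with h
      · rfl
      · rw [coeff_toSeries, hN n (by omega), zero_mul]
    simpa using this

theorem basisVec_mem (hq0 : 0 < q) (hq1 : q < 1) (hl : 0 < l) (n : ℕ) :
    basisVec n ∈ polySubspace q l :=
  (mem_polySubspace_iff hq0 hq1 hl _).2 ⟨n + 1, fun m hm => by
    rw [basisVec_apply, if_neg (by omega)]⟩

theorem polySubspace_eq_span (hq0 : 0 < q) (hq1 : q < 1) (hl : 0 < l) :
    polySubspace q l = Submodule.span ℂ (Set.range basisVec) := by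
  refine le_antisymm (fun b hb => ?_)
    (Submodule.span_le.2 (Set.range_subset_iff.2 (basisVec_mem hq0 hq1 hl)))
  obtain ⟨N, hN⟩ := (mem_polySubspace_iff hq0 hq1 hl b).1 hb
  have : b = ∑ n ∈ Finset.range N, b n • basisVec n := by
    ext m
    rw [lp.coeFn_sum, Finset.sum_apply]
    simp only [lp.coeFn_smul, Pi.smul_apply, basisVec_apply, smul_eq_mul, mul_ite, mul_one,
      mul_zero, Finset.sum_ite_eq, Finset.mem_range]
    split_ifs with h
    · rfl
    · exact hN m (by omega)
  rw [this]
  exact Submodule.sum_mem _ fun n _ =>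
    Submodule.smul_mem _ _ (Submodule.subset_span (Set.mem_range_self n))

theorem dense_domain (hq0 : 0 < q) (hq1 : q < 1) (hl : 0 < l) :
    Dense ((I3 q l).domain : Set Hl) := by
  intro b
  have h := lp.hasSum_single (p := 2) (by norm_num) b
  refine mem_closure_of_tendsto h (Filter.Eventually.of_forall fun s => ?_)
  refine Submodule.sum_mem _ fun n _ => ?_
  have h2 : lp.single 2 n (b n) = b n • basisVec n := by
    rw [basisVec, ← lp.single_smul, smul_eq_mul, mul_one]
  rw [h2]
  exact Submodule.smul_mem _ _ (basisVec_mem hq0 hq1 hl n)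

theorem I3_apply (b : (I3 q l).domain) (n : ℕ) : (I3 q l b : Hl) n =
    PowerSeries.coeff n (I3Formal q l (toSeries q l b)) / (normConst q l n : ℂ) := rfl

/-- `⟨v, I₃ f_n⟩` is the complex conjugate of the `n`-th coordinate of the formal series
`I₃ v`. -/
theorem inner_I3_basisVec (hq0 : 0 < q) (hq1 : q < 1) (hl : 0 < l) (v : Hl) (n : ℕ) :
    inner ℂ v (I3 q l ⟨basisVec n, basisVec_mem hq0 hq1 hl n⟩) = starRingEnd ℂ
      (PowerSeries.coeff n (I3Formal q l (toSeries q l v)) / (normConst q l n : ℂ)) := by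
  rcases n with _ | n
  · have h : I3 q l ⟨basisVec 0, basisVec_mem hq0 hq1 hl 0⟩ =
        (diag q l 0 : ℂ) • basisVec 0 + (offDiag q l 0 : ℂ) • basisVec 1 := by
      ext m
      rw [I3_apply]
      simp only [lp.coeFn_add, lp.coeFn_smul, Pi.add_apply, Pi.smul_apply, basisVec_apply,
        smul_eq_mul]
      rcases m with _ | m
      · rw [coeff_zero_I3Formal_toSeries hq0 hq1]
        simp [basisVec_apply]
      · rw [coeff_succ_I3Formal_toSeries hq0 hq1 hl]
        rcases m with _ | m <;> simp [basisVec_apply]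
    rw [h, coeff_zero_I3Formal_toSeries hq0 hq1]
    simp only [inner_add_right, inner_smul_right, inner_basisVec_right, map_add, map_mul,
      Complex.conj_ofReal]
  · have h : I3 q l ⟨basisVec (n + 1), basisVec_mem hq0 hq1 hl (n + 1)⟩ =
        (offDiag q l n : ℂ) • basisVec n + (diag q l (n + 1) : ℂ) • basisVec (n + 1) +
          (offDiag q l (n + 1) : ℂ) • basisVec (n + 2) := by
      ext m
      rw [I3_apply]
      simp only [lp.coeFn_add, lp.coeFn_smul, Pi.add_apply, Pi.smul_apply, basisVec_apply,
        smul_eq_mul]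
      rcases m with _ | m
      · rw [coeff_zero_I3Formal_toSeries hq0 hq1]
        rcases n with _ | n <;> simp [basisVec_apply]
      · rw [coeff_succ_I3Formal_toSeries hq0 hq1 hl]
        simp only [basisVec_apply]
        rcases lt_trichotomy m n with hmn | rfl | hmn
        · rcases eq_or_ne (m + 1) n with rfl | h1
          · simp [show m ≠ m + 1 + 1 by omega]
          · simp [h1, show m ≠ n + 1 by omega, show m ≠ n by omega]
        · simp
        · rcases eq_or_ne m (n + 1) with rfl | h1
          · simp [show n + 1 + 1 ≠ n by omega]
          · simp [h1, show m + 1 ≠ n by omega, show m ≠ n by omega, show m + 2 ≠ n + 1 by omega]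
    rw [h, coeff_succ_I3Formal_toSeries hq0 hq1 hl]
    simp only [inner_add_right, inner_smul_right, inner_basisVec_right, map_add, map_mul,
      Complex.conj_ofReal]

/-- `w` represents the functional `⟨v, I₃ ·⟩` on polynomials exactly when `w` is the formal image
of `v` under `I₃`. -/
theorem forall_inner_eq_iff (hq0 : 0 < q) (hq1 : q < 1) (hl : 0 < l) (v w : Hl) :
    (∀ x : (I3 q l).domain, inner ℂ w (x : Hl) = inner ℂ v (I3 q l x)) ↔
      I3Formal q l (toSeries q l v) = toSeries q l w := by
  have key (n : ℕ) : inner ℂ w (basisVec n : Hl) =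
      inner ℂ v (I3 q l ⟨basisVec n, basisVec_mem hq0 hq1 hl n⟩) ↔
      PowerSeries.coeff n (I3Formal q l (toSeries q l v)) =
        PowerSeries.coeff n (toSeries q l w) := by
    rw [inner_I3_basisVec hq0 hq1 hl, inner_basisVec_right, (starRingEnd ℂ).injective.eq_iff, coeff_toSeries,
      eq_div_iff (normConst_ne_zero hq0 hq1 hl n), eq_comm]
  constructor
  · intro h
    ext n
    exact (key n).1 (h ⟨basisVec n, basisVec_mem hq0 hq1 hl n⟩)
  · rintro h ⟨x, hx⟩
    have hx' : x ∈ Submodule.span ℂ (Set.range basisVec) :=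
      polySubspace_eq_span hq0 hq1 hl ▸ hx
    -- Bundling domain membership with the equation gives a predicate on vectors alone, as span
    -- induction requires.
    suffices ∃ hx : x ∈ (I3 q l).domain, inner ℂ w x = inner ℂ v (I3 q l ⟨x, hx⟩) from this.2
    clear hx
    induction hx' using Submodule.span_induction with
    | mem x h1 =>
      obtain ⟨n, rfl⟩ := h1
      exact ⟨basisVec_mem hq0 hq1 hl n, (key n).2 (by rw [h])⟩
    | zero => exact ⟨zero_mem _, by
        rw [show (⟨0, zero_mem _⟩ : (I3 q l).domain) = 0 from rfl, LinearPMap.map_zero]; simp⟩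
    | add x y h1 h2 ih1 ih2 =>
      obtain ⟨hx, ih1⟩ := ih1
      obtain ⟨hy, ih2⟩ := ih2
      refine ⟨add_mem hx hy, ?_⟩
      rw [show (⟨x + y, add_mem hx hy⟩ : (I3 q l).domain) = ⟨x, hx⟩ + ⟨y, hy⟩ from rfl,
        LinearPMap.map_add, inner_add_right, inner_add_right, ih1, ih2]
    | smul a x h1 ih =>
      obtain ⟨hx, ih⟩ := ih
      refine ⟨Submodule.smul_mem _ a hx, ?_⟩
      rw [show (⟨a • x, Submodule.smul_mem _ a hx⟩ : (I3 q l).domain) = a • ⟨x, hx⟩ from rfl,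
        LinearPMap.map_smul, inner_smul_right, inner_smul_right, ih]

theorem toSeries_I3 (hq0 : 0 < q) (hq1 : q < 1) (hl : 0 < l) (b : (I3 q l).domain) :
    toSeries q l (I3 q l b) = I3Formal q l (toSeries q l b) := by
  ext n
  rw [coeff_toSeries, I3_apply, div_mul_cancel₀ _ (normConst_ne_zero hq0 hq1 hl n)]

/-- On polynomials the operator is the formal one, so symmetry is the case `v = x`, `w = I₃ x` of
`forall_inner_eq_iff`. -/
theorem I3_isFormalAdjoint (hq0 : 0 < q) (hq1 : q < 1) (hl : 0 < l) :
    (I3 q l).IsFormalAdjoint (I3 q l) := fun x y =>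
  (forall_inner_eq_iff hq0 hq1 hl x (I3 q l x)).2 (toSeries_I3 hq0 hq1 hl x).symm y

theorem I3_isClosable (hq0 : 0 < q) (hq1 : q < 1) (hl : 0 < l) : (I3 q l).IsClosable :=
  LinearPMap.isClosable_iff_exists_closed_extension.2
    ⟨(I3 q l)†, LinearPMap.adjoint_isClosed (dense_domain hq0 hq1 hl),
      (I3_isFormalAdjoint hq0 hq1 hl).le_adjoint (dense_domain hq0 hq1 hl)⟩

theorem I3Closed_isClosed (hq0 : 0 < q) (hq1 : q < 1) (hl : 0 < l) : (I3Closed q l).IsClosed :=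
  (I3_isClosable hq0 hq1 hl).closure_isClosed

theorem I3_le_I3Closed : I3 q l ≤ I3Closed q l := (I3 q l).le_closure

theorem dense_domain_I3Closed (hq0 : 0 < q) (hq1 : q < 1) (hl : 0 < l) :
    Dense ((I3Closed q l).domain : Set Hl) :=
  (dense_domain hq0 hq1 hl).mono I3_le_I3Closed.1

/-- For fixed `v` and `w` the relation is a closed condition on pairs in `H × H`, so it passes from
the graph to its closure. Closing `I₃` therefore does not change the adjoint. -/
theorem inner_I3Closed_of_inner_I3 (hq0 : 0 < q) (hq1 : q < 1) (hl : 0 < l) {v w : Hl}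
    (h : ∀ x : (I3 q l).domain, inner ℂ w (x : Hl) = inner ℂ v (I3 q l x))
    (x : (I3Closed q l).domain) : inner ℂ w (x : Hl) = inner ℂ v (I3Closed q l x) := by
  have hx : ((x : Hl), I3Closed q l x) ∈ (I3 q l).graph.topologicalClosure := by
    rw [(I3_isClosable hq0 hq1 hl).graph_closure_eq_closure_graph]
    exact LinearPMap.mem_graph _ x
  have hcl : IsClosed {p : Hl × Hl | inner ℂ w p.1 = inner ℂ v p.2} :=
    isClosed_eq (by fun_prop) (by fun_prop)
  refine closure_minimal (s := ((I3 q l).graph : Set (Hl × Hl))) ?_ hcl hx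
  rintro ⟨a, b⟩ hab
  obtain ⟨f, rfl, rfl⟩ := (LinearPMap.mem_graph_iff _).1 hab
  exact h f

theorem I3Closed_isFormalAdjoint (hq0 : 0 < q) (hq1 : q < 1) (hl : 0 < l) :
    (I3Closed q l).IsFormalAdjoint (I3Closed q l) := by
  intro x y
  -- The closure is taken in one variable at a time: here in `y`, then in `x` against a polynomial
  -- `z`.
  refine inner_I3Closed_of_inner_I3 hq0 hq1 hl (fun z => ?_) y
  have h := inner_I3Closed_of_inner_I3 hq0 hq1 hl (I3_isFormalAdjoint hq0 hq1 hl z) x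
  rw [← inner_conj_symm, ← h, inner_conj_symm]

/-- The adjoint of the closure of `I₃` is the formal operator `I₃` with its maximal domain. -/
theorem I3Formal_toSeries_eq_iff (hq0 : 0 < q) (hq1 : q < 1) (hl : 0 < l) (v w : Hl) :
    I3Formal q l (toSeries q l v) = toSeries q l w ↔
      ∃ hv : v ∈ (I3Closed q l)†.domain, (I3Closed q l)† ⟨v, hv⟩ = w := by
  have hd := dense_domain_I3Closed hq0 hq1 hl
  rw [← forall_inner_eq_iff hq0 hq1 hl]
  refine ⟨fun h => exists_adjoint_eq hd (inner_I3Closed_of_inner_I3 hq0 hq1 hl h), ?_⟩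
  rintro ⟨hv, rfl⟩ x
  rw [LinearPMap.adjoint_isFormalAdjoint hd ⟨v, hv⟩ ⟨x, I3_le_I3Closed.1 x.2⟩]
  congr 1
  exact (I3_le_I3Closed.2 rfl).symm

end Operator

/-! ### Eigenvectors of the adjoint and their consequences. -/

section Deficiency

variable {q l : ℝ}

/-- The eigenvector `ζ_λ` as an element of the Hilbert space. -/
noncomputable def eigenVec (hq0 : 0 < q) (hq1 : q < 1) (hl : 0 < l) (lam : ℂ) : Hl :=
  ⟨fun n => overlap q l n lam, Memℓp.of_exponent_ge
    (memℓp_gen (p := 1) (by simpa using summable_norm_overlap hq0 hq1 hl lam))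
    (by norm_num)⟩

variable (hq0 : 0 < q) (hq1 : q < 1) (hl : 0 < l)
include hq0 hq1 hl

theorem eigenVec_apply (lam : ℂ) (n : ℕ) : eigenVec hq0 hq1 hl lam n = overlap q l n lam := rfl

theorem toSeries_eigenVec (lam : ℂ) :
    toSeries q l (eigenVec hq0 hq1 hl lam) = eigenSeries q l lam := rfl

theorem eigenVec_ne_zero (lam : ℂ) : eigenVec hq0 hq1 hl lam ≠ 0 := by
  intro h
  have h1 := coeff_zero_eigenSeries hq0 hq1 hl lam
  rw [← toSeries_eigenVec hq0 hq1 hl, h, map_zero, map_zero] at h1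
  exact zero_ne_one h1

theorem exists_adjoint_eigenVec (lam : ℂ) :
    ∃ hz : eigenVec hq0 hq1 hl lam ∈ (I3Closed q l)†.domain,
      (I3Closed q l)† ⟨eigenVec hq0 hq1 hl lam, hz⟩ = lam • eigenVec hq0 hq1 hl lam := by
  rw [← I3Formal_toSeries_eq_iff hq0 hq1 hl, map_smul, toSeries_eigenVec,
    I3Formal_eigenSeries hq0 hq1 hl]

/-- The eigenvector `ζ_λ` as an element of the domain of the adjoint. -/
noncomputable def eigenDom (lam : ℂ) : (I3Closed q l)†.domain :=
  ⟨eigenVec hq0 hq1 hl lam, (exists_adjoint_eigenVec hq0 hq1 hl lam).1⟩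

theorem adjoint_eigenDom (lam : ℂ) : (I3Closed q l)† (eigenDom hq0 hq1 hl lam) =
    lam • (eigenDom hq0 hq1 hl lam : Hl) :=
  (exists_adjoint_eigenVec hq0 hq1 hl lam).2

theorem eigenDom_ne_zero (lam : ℂ) : (eigenDom hq0 hq1 hl lam : Hl) ≠ 0 :=
  eigenVec_ne_zero hq0 hq1 hl lam

/-- The adjoint acts as the formal operator, so uniqueness of formal eigenseries carries over to its
eigenvectors. -/
theorem exists_eq_smul_eigenDom (lam : ℂ) (m : (I3Closed q l)†.domain)
    (hm : (I3Closed q l)† m = lam • (m : Hl)) : ∃ a : ℂ, m = a • eigenDom hq0 hq1 hl lam := by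
  have h := (I3Formal_toSeries_eq_iff hq0 hq1 hl (m : Hl) (lam • (m : Hl))).2 ⟨m.2, hm⟩
  rw [map_smul, I3Formal_eq_smul_iff hq0 hq1 hl] at h
  obtain ⟨a, ha⟩ := h
  refine ⟨a, Subtype.ext (toSeries_injective hq0 hq1 hl ?_)⟩
  rw [ha, SetLike.val_smul, map_smul]
  rfl

theorem deficiencyIndex_eq_one (lam : ℂ) : deficiencyIndex (I3Closed q l) lam = 1 := by
  have hmem (m : (I3Closed q l)†.domain) : m ∈ LinearMap.ker ((I3Closed q l)†.toFun -
      lam • (I3Closed q l)†.domain.subtype) ↔ (I3Closed q l)† m = lam • (m : Hl) := by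
    rw [LinearMap.mem_ker, LinearMap.sub_apply, sub_eq_zero]
    rfl
  refine rank_eq_one ⟨eigenDom hq0 hq1 hl lam, (hmem _).2 (adjoint_eigenDom hq0 hq1 hl lam)⟩ ?_ ?_
  · intro h
    exact eigenDom_ne_zero hq0 hq1 hl lam (congrArg Subtype.val (congrArg Subtype.val h))
  · rintro ⟨m, hm⟩
    obtain ⟨a, rfl⟩ := exists_eq_smul_eigenDom hq0 hq1 hl lam m ((hmem m).1 hm)
    exact ⟨a, rfl⟩

/-- The `P_n` have real coefficients, so conjugating `λ` conjugates every coordinate. At `λ = i`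
this is the equality of norms that von Neumann's construction needs. -/
theorem norm_eigenVec_conj (lam : ℂ) :
    ‖eigenVec hq0 hq1 hl (starRingEnd ℂ lam)‖ = ‖eigenVec hq0 hq1 hl lam‖ := by
  have h (n : ℕ) : overlap q l n (starRingEnd ℂ lam) = starRingEnd ℂ (overlap q l n lam) := by
    rw [overlap, overlap, map_mul, Complex.conj_ofReal, ← qLaguerre_conj]
    simp only [map_mul, map_sub, map_one, map_ofNat, Complex.conj_ofReal]
  rw [lp.norm_eq_tsum_rpow (by norm_num), lp.norm_eq_tsum_rpow (by norm_num)]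
  simp only [eigenVec_apply, h, RCLike.norm_conj]

/-- A selfadjoint closure would make the adjoint symmetric, yet the adjoint has the nonreal
eigenvalue `i`. -/
theorem not_isSelfAdjoint_I3Closed : ¬ IsSelfAdjoint (I3Closed q l) := by
  intro h
  rw [LinearPMap.isSelfAdjoint_def] at h
  have hs := LinearPMap.adjoint_isFormalAdjoint (dense_domain_I3Closed hq0 hq1 hl)
  nth_rw 2 [← h] at hs
  have h1 := hs (eigenDom hq0 hq1 hl Complex.I) (eigenDom hq0 hq1 hl Complex.I)
  rw [adjoint_eigenDom, inner_smul_left, inner_smul_right, Complex.conj_I] at h1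
  have h2 : Complex.I * inner ℂ (eigenDom hq0 hq1 hl Complex.I : Hl)
      (eigenDom hq0 hq1 hl Complex.I : Hl) = 0 := by linear_combination (-1 / 2 : ℂ) * h1
  rw [mul_eq_zero, or_iff_right Complex.I_ne_zero, inner_self_eq_zero] at h2
  exact eigenDom_ne_zero hq0 hq1 hl _ h2

theorem not_bounded_I3 :
    ¬ ∃ C : ℝ, ∀ f : (I3 q l).domain, ‖I3 q l f‖ ≤ C * ‖(f : Hl)‖ := by
  rintro ⟨C, hC⟩
  -- A bound `C` for `I₃` would, by density, give `λ ‖z‖² ≤ C ‖z‖²` for an eigenvector `z` of the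
  -- adjoint with real eigenvalue `λ`; any positive `λ > C` contradicts this.
  let lam : ℝ := |C| + 1
  set z := eigenVec hq0 hq1 hl lam
  have hz : 0 < ‖z‖ := norm_pos_iff.2 (eigenVec_ne_zero hq0 hq1 hl lam)
  have hI : ∀ x : (I3 q l).domain, inner ℂ ((lam : ℂ) • z) (x : Hl) = inner ℂ z (I3 q l x) := by
    rw [forall_inner_eq_iff hq0 hq1 hl, map_smul, toSeries_eigenVec,
      I3Formal_eigenSeries hq0 hq1 hl]
  have hle (f : Hl) : ‖inner ℂ ((lam : ℂ) • z) f‖ ≤ ‖z‖ * (C * ‖f‖) := by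
    refine (dense_domain hq0 hq1 hl).induction (P := fun f : Hl =>
      ‖inner ℂ ((lam : ℂ) • z) f‖ ≤ ‖z‖ * (C * ‖f‖)) (fun f hf => ?_)
      (isClosed_le (by fun_prop) (by fun_prop)) f
    rw [hI ⟨f, hf⟩]
    exact (norm_inner_le_norm _ _).trans (by gcongr; exact hC ⟨f, hf⟩)
  have h1 := hle z
  have hlam : 0 < lam := by positivity
  rw [inner_smul_left, norm_mul, RCLike.norm_conj, Complex.norm_real, Real.norm_of_nonneg hlam.le,
    inner_self_eq_norm_sq_to_K] at h1
  simp only [Complex.coe_algebraMap, norm_pow, Complex.norm_real, norm_norm] at h1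
  have h2 : C < lam := by have := le_abs_self C; simp only [lam]; linarith
  nlinarith [mul_pos hz hz]

theorem infinite_selfAdjoint_extensions_I3Closed :
    {T : Hl →ₗ.[ℂ] Hl | IsSelfAdjoint T ∧ I3Closed q l ≤ T}.Infinite :=
  infinite_selfAdjoint_extensions (dense_domain_I3Closed hq0 hq1 hl)
    (I3Closed_isFormalAdjoint hq0 hq1 hl) (I3Closed_isClosed hq0 hq1 hl)
    (eigenDom hq0 hq1 hl Complex.I) (eigenDom hq0 hq1 hl (-Complex.I))
    (adjoint_eigenDom hq0 hq1 hl _) (adjoint_eigenDom hq0 hq1 hl _)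
    (exists_eq_smul_eigenDom hq0 hq1 hl _) (exists_eq_smul_eigenDom hq0 hq1 hl _)
    (eigenDom_ne_zero hq0 hq1 hl _) (by
      have h := norm_eigenVec_conj hq0 hq1 hl Complex.I
      rw [Complex.conj_I] at h
      exact h.symm)

end Deficiency

end QSU11

theorem mainTheorem8 (q l : ℝ) (hq0 : 0 < q) (hq1 : q < 1) (hl : 0 < l) :
    -- `I₃` is a densely defined, unbounded, symmetric, closable operator
    Dense ((QSU11.I3 q l).domain : Set QSU11.Hl) ∧
    (QSU11.I3 q l).IsFormalAdjoint (QSU11.I3 q l) ∧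
    (¬ ∃ C : ℝ, ∀ f : (QSU11.I3 q l).domain, ‖QSU11.I3 q l f‖ ≤ C * ‖(f : QSU11.Hl)‖) ∧
    (QSU11.I3 q l).IsClosable ∧
    -- its closure is symmetric, not selfadjoint, and has deficiency indices `(1,1)`
    (QSU11.I3Closed q l).IsFormalAdjoint (QSU11.I3Closed q l) ∧
    ¬ IsSelfAdjoint (QSU11.I3Closed q l) ∧
    QSU11.deficiencyIndex (QSU11.I3Closed q l) Complex.I = 1 ∧
    QSU11.deficiencyIndex (QSU11.I3Closed q l) (-Complex.I) = 1 ∧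
    -- it has infinitely many selfadjoint extensions
    {T : QSU11.Hl →ₗ.[ℂ] QSU11.Hl | IsSelfAdjoint T ∧ QSU11.I3Closed q l ≤ T}.Infinite ∧
    ∀ lam : ℂ,
      -- the formal eigenfunctions are the multiples of `ζ_λ = ∑ P_n(λ) f_n`
      (∀ ζ : PowerSeries ℂ, QSU11.I3Formal q l ζ = lam • ζ ↔
        ∃ a : ℂ, ζ = a • QSU11.eigenSeries q l lam) ∧
      -- `ζ_λ` lies in the Hilbert space, has overlap coefficients `P_n(λ)`, and is an
      -- eigenvector of the adjoint operator
      (∃ z : QSU11.Hl, QSU11.toSeries q l z = QSU11.eigenSeries q l lam ∧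
        (∀ n : ℕ, inner ℂ (QSU11.basisVec n) z = QSU11.overlap q l n lam) ∧
        ∃ hz : z ∈ ((QSU11.I3Closed q l)†).domain,
          (QSU11.I3Closed q l)† ⟨z, hz⟩ = lam • z) ∧
      -- the explicit form of `ζ_λ`, with `ν = 2 (1 - q) λ`
      (∀ x : ℂ, ‖x‖ < q ^ ((2 * l - 3) / 4) →
        HasSum (fun n : ℕ => PowerSeries.coeff n (QSU11.eigenSeries q l lam) * x ^ n)
          (1 / QSU11.qPochInf ((q ^ ((3 - 2 * l) / 4) : ℝ) * x) q *
            QSU11.phi11 (-(2 * (1 - q) * lam)) 0 q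
              ((q ^ (3 * (1 + 2 * l) / 4) : ℝ) * x))) := by
  refine ⟨QSU11.dense_domain hq0 hq1 hl, QSU11.I3_isFormalAdjoint hq0 hq1 hl, QSU11.not_bounded_I3 hq0 hq1 hl,
    QSU11.I3_isClosable hq0 hq1 hl, QSU11.I3Closed_isFormalAdjoint hq0 hq1 hl,
    QSU11.not_isSelfAdjoint_I3Closed hq0 hq1 hl, QSU11.deficiencyIndex_eq_one hq0 hq1 hl _,
    QSU11.deficiencyIndex_eq_one hq0 hq1 hl _,
    QSU11.infinite_selfAdjoint_extensions_I3Closed hq0 hq1 hl, fun lam => ⟨?_, ?_, ?_⟩⟩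
  · exact QSU11.I3Formal_eq_smul_iff hq0 hq1 hl lam
  · exact ⟨QSU11.eigenVec hq0 hq1 hl lam, QSU11.toSeries_eigenVec hq0 hq1 hl lam,
      fun n => QSU11.inner_basisVec n _, QSU11.exists_adjoint_eigenVec hq0 hq1 hl lam⟩
  · exact QSU11.hasSum_eigenSeries hq0 hq1 hl lam
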